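/- Consider $n$ agents with positions $q_i(t)\in\mathbb{R}^m$ and dynamics $\ddot q_i=u_i$, $t\ge 0$. They interact over an undirected time-varying graph with measurable weights $a_{ij}(t)=a_{ji}(t)\ge 0$, $a_{ii}(t)=0$, $a_{ij}(t)\le a_M$, which is jointly $(\delta,T)$-connected for some $\delta,T>0$: for every $t\ge 0$ the edges $(j,i)$ with $\int_t^{t+T}a_{ij}(s)\,ds\ge\delta$ form a connected graph on $\{1,\dots,n\}$. Let $A=[a_{ij}]$, $D=\mathrm{diag}(\sum_j a_{1j},\dots,\sum_j a_{nj})$, $\mathcal L=D-A$, $Q=D+A$. Neighbours measure $z_{ij}=q_i-q_j+b_i$ with constant unknown sensor biases $b_i\in\mathbb{R}^m$. Let $k:[0,\infty)\to(0,\infty)$ be measurable and bounded, and let $\lambda,\sigma,\beta,\mu_F,\mu_{IF}>0$ be gains. Put $\theta=(1,1,b_1,\dots,b_n)\in\mathbb{R}^{mn+2}$. Agent $i$ has the estimate $\hat\theta^i=(p^i,l^i,\hat b^i_1,\dots,\hat b^i_n)$ of $\theta$, where $\hat b^i_j$ is its estimate of $b_j$; let $\tilde\theta^i=\theta-\hat\theta^i$,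 $\tilde b_i^i=b_i-\hat b_i^i$, and define $$s_i=\dot q_i+\lambda\Big(q_i+\tfrac12\tilde b^i_i\Big),\qquad Z_i=\Big[0,\;0,\;-\tfrac{k(t)}2[Q_{i1}(t)I_m,\dots,Q_{in}(t)I_m]\Big],\qquad Y_i=\Big[\ddot q_i,\;k(t)\dot q_i,\;\tfrac{k(t)}2[Q_{i1}(t)I_m,\dots,Q_{in}(t)I_m]\Big].$$ The control law is $$u_i=Z_i\tilde\theta^i-\sigma\sum_j\mathcal L_{ij}(t)s_j-\lambda\dot q_i-\tfrac{\lambda}{2}\dot{\tilde b}{}_i^i ,$$ which equals $k(t)\big(-\dot q_i-\tfrac12\sum_j a_{ij}(t)(z_{ij}+z_{ji})\big)+w_i$ with the auxiliary control $$w_i=k(t)\dot q_i-\lambda\Big(\dot q_i+\tfrac12\dot{\tilde b}{}_i^i\Big)-\sigma\sum_j\mathcal L_{ij}(t)s_j-Z_i\hat\theta^i .$$ The filters, all with zero initial value, are $$\dot Y_{F_i}=-\beta Y_{F_i}+Y_i,\qquad \dot w_{F_i}=-\beta w_{F_i}+w_i,\qquad \dot Y_{IF_i}=Y_{F_i}^\top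 Y_{F_i},\qquad \dot w_{IF_i}=Y_{F_i}^\top w_{F_i},$$ and the adaptation law, with arbitrary initial value, is $$\dot{\hat\theta}{}^i=\mu_FY_{F_i}^\top(w_{F_i}-Y_{F_i}\hat\theta^i)+\mu_{IF}(w_{IF_i}-Y_{IF_i}\hat\theta^i)-\sum_j a_{ij}(t)(\hat\theta^i-\hat\theta^j).$$ Then there is $\mu^*>0$, depending only on the graph, on $k$ and on $\lambda,\sigma,\beta,\mu_F$, such that the following holds for every $\mu_{IF}>\mu^*$, all biases $b_1,\dots,b_n$ and every solution of the closed loop on $[0,\infty)$ (absolutely continuous on bounded intervals, with the equations holding almost everywhere). Suppose that the filtered regressors $Y_{F_i}$ are collectively initially exciting (C-IE): they are bounded and locally integrable, and for some $t_0\ge 0$, $\bar T>0$, $\gamma>0$, $$\int_{t_0}^{t_0+\bar T}\sum_{i=1}^nY_{F_i}^\top(\tau)Y_{F_i}(\tau)\,d\tau\;\ge\;\gamma I_{mn+2}.$$ Then for all $i,j,l$ the differences $q_i-q_j$, the velocities $\dot q_i$ and the bias errors $b_i-\hat b_i^l$ converge to $0$ exponentially for $t\ge t_0+\bar T$, that is,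 each of them is bounded in norm by $Ce^{-\alpha(t-t_0-\bar T)}$ for all $t\ge t_0+\bar T$, with constants $C$ and $\alpha>0$ that may depend on the solution. Moreover the trajectories $q_i,\dot q_i,s_i,\tilde\theta^i$ and the signals $w_i$ are bounded uniformly in $t\ge0$. -/

import Mathlib

open MeasureTheory

noncomputable section

/-! ### Time-varying weighted graphs -/

/-- `a t` is the adjacency matrix at time `t ≥ 0` of an undirected weighted graph without self
edges (`i`, `j` are joined at time `t` iff `0 < a t i j`), with weights bounded by `aM`. -/
structure IsUndirectedNetwork {n : ℕ} (a : ℝ → Matrix (Fin n) (Fin n) ℝ) (aM : ℝ) : Prop where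
  measurable : ∀ i j, AEMeasurable (fun t => a t i j) (volume.restrict (Set.Ici 0))
  nonneg : ∀ t, 0 ≤ t → ∀ i j, 0 ≤ a t i j
  symm : ∀ t, 0 ≤ t → ∀ i j, a t i j = a t j i
  loopless : ∀ t, 0 ≤ t → ∀ i, a t i i = 0
  bounded : ∀ t, 0 ≤ t → ∀ i j, a t i j ≤ aM

/-- The graph of those pairs of distinct nodes that are joined, in at least one direction, by an
edge whose weight integrates to at least `δ` over `[t, t + T]`. -/
def jointGraph {n : ℕ} (a : ℝ → Matrix (Fin n) (Fin n) ℝ) (δ T t : ℝ) : SimpleGraph (Fin n) :=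
  SimpleGraph.fromRel fun i j => δ ≤ ∫ τ in t..(t + T), a τ i j

/-- Joint `(δ, T)`-connectedness. -/
def IsJointlyConnected {n : ℕ} (a : ℝ → Matrix (Fin n) (Fin n) ℝ) (δ T : ℝ) : Prop :=
  ∀ t, 0 ≤ t → (jointGraph a δ T t).Connected

/-- The degree matrix of a weighted adjacency matrix. -/
def degreeMat {n : ℕ} (A : Matrix (Fin n) (Fin n) ℝ) : Matrix (Fin n) (Fin n) ℝ :=
  Matrix.diagonal fun i => ∑ j, A i j

/-- The Laplacian `D - A`. -/
def laplacianMat {n : ℕ} (A : Matrix (Fin n) (Fin n) ℝ) : Matrix (Fin n) (Fin n) ℝ :=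
  degreeMat A - A

/-- The signless Laplacian `D + A`. -/
def signlessMat {n : ℕ} (A : Matrix (Fin n) (Fin n) ℝ) : Matrix (Fin n) (Fin n) ℝ :=
  degreeMat A + A

/-! ### Collective initial excitation -/

/-- The signals `φ 1, …, φ n` on `[0, ∞)` are bounded, locally integrable and collectively
initially exciting, with window `[t₀, t₀ + Tbar]` and level `γ`:
`∫_{t₀}^{t₀ + Tbar} ∑ i, φ i (τ)ᵀ φ i (τ) dτ ≥ γ I`. -/
structure IsCIE {n : ℕ} {ι κ : Type} [Fintype ι] [Fintype κ] [DecidableEq κ]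
    (φ : ℝ → Fin n → Matrix ι κ ℝ) (t₀ Tbar γ : ℝ) : Prop where
  bounded : ∃ B : ℝ, ∀ t, 0 ≤ t → ∀ i r c, |φ t i r c| ≤ B
  locallyIntegrable : ∀ i r c, LocallyIntegrableOn (fun t => φ t i r c) (Set.Ici 0)
  start_nonneg : 0 ≤ t₀
  window_pos : 0 < Tbar
  level_pos : 0 < γ
  excitation : ((Matrix.of fun c d =>
      ∫ τ in t₀..(t₀ + Tbar), (∑ i, (φ τ i).transpose * φ τ i) c d) -
        γ • (1 : Matrix κ κ ℝ)).PosSemidef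

/-! ### The closed loop -/

/-- Index type of the parameter vector `θ = (1, 1, b) ∈ ℝ^(mn+2)`: `inl 0` and `inl 1` are the
first two entries, and `inr (j, c)` is the `c`-th coordinate of the bias of sensor `j`. -/
abbrev ParamIdx (n m : ℕ) : Type := Fin 2 ⊕ (Fin n × Fin m)

/-- The control and filter gains, apart from `μ_IF`. -/
structure Gains where
  lam : ℝ
  sigma : ℝ
  beta : ℝ
  muF : ℝ

/-- All gains are positive. -/
structure Gains.Positive (g : Gains) : Prop where
  lam_pos : 0 < g.lam
  sigma_pos : 0 < g.sigma
  beta_pos : 0 < g.beta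
  muF_pos : 0 < g.muF

/-- The values at one instant of all the variables with dynamics: positions `q`, velocities `v`,
parameter estimates `θhat i = (p^i, l^i, bhat^i)`, and the states of the two filters. -/
structure NetState (n m : ℕ) where
  q : Fin n → Fin m → ℝ
  v : Fin n → Fin m → ℝ
  θhat : Fin n → ParamIdx n m → ℝ
  YF : Fin n → Matrix (Fin m) (ParamIdx n m) ℝ
  wF : Fin n → Fin m → ℝ
  YIF : Fin n → Matrix (ParamIdx n m) (ParamIdx n m) ℝ
  wIF : Fin n → ParamIdx n m → ℝ

section Laws

variable {n m : ℕ}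

/-- The true parameter `θ = (1, 1, b)`. -/
def trueParam (b : Fin n → Fin m → ℝ) : ParamIdx n m → ℝ :=
  Sum.elim (fun _ => 1) fun p => b p.1 p.2

/-- The parameter error `θ - θhat^i` of agent `i`. -/
def paramErr (b : Fin n → Fin m → ℝ) (x : NetState n m) (i : Fin n) : ParamIdx n m → ℝ :=
  trueParam b - x.θhat i

/-- The estimate `bhat_j^i` that agent `i` has of the bias of sensor `j`. -/
def biasEst (x : NetState n m) (j i : Fin n) : Fin m → ℝ :=
  fun c => x.θhat i (Sum.inr (j, c))

/-- The right-hand side of the adaptation law for `θhat^i`; `A` is the current adjacency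
matrix. -/
def adaptRate (g : Gains) (muIF : ℝ) (A : Matrix (Fin n) (Fin n) ℝ) (x : NetState n m)
    (i : Fin n) : ParamIdx n m → ℝ :=
  g.muF • ((x.YF i).transpose.mulVec (x.wF i - (x.YF i).mulVec (x.θhat i)))
    + muIF • (x.wIF i - (x.YIF i).mulVec (x.θhat i))
    - ∑ j, A i j • (x.θhat i - x.θhat j)

/-- The time derivative of `b_i - bhat_i^i`: minus the corresponding block of the adaptation
law, the bias being constant. -/
def ownBiasErrRate (g : Gains) (muIF : ℝ) (A : Matrix (Fin n) (Fin n) ℝ) (x : NetState n m)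
    (i : Fin n) : Fin m → ℝ :=
  fun c => -adaptRate g muIF A x i (Sum.inr (i, c))

/-- `s_i = v_i + lam (q_i + (b_i - bhat_i^i) / 2)`. -/
def sVar (g : Gains) (b : Fin n → Fin m → ℝ) (x : NetState n m) (i : Fin n) : Fin m → ℝ :=
  x.v i + g.lam • (x.q i + (1 / 2 : ℝ) • (b i - biasEst x i i))

/-- The matrix `Z_i = [0, 0, -(k/2) [Q_{i1} I, …, Q_{in} I]]`. -/
def Zmat (A : Matrix (Fin n) (Fin n) ℝ) (k : ℝ) (i : Fin n) : Matrix (Fin m) (ParamIdx n m) ℝ :=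
  Matrix.of fun r => Sum.elim (fun _ => 0) fun p =>
    if r = p.2 then -(1 / 2) * k * signlessMat A i p.1 else 0

/-- The control
`u_i = Z_i (θ - θhat^i) - sigma ∑ j, L_ij s_j - lam v_i - (lam/2) d/dt (b_i - bhat_i^i)`. -/
def controlLaw (g : Gains) (muIF : ℝ) (A : Matrix (Fin n) (Fin n) ℝ) (k : ℝ)
    (b : Fin n → Fin m → ℝ) (x : NetState n m) (i : Fin n) : Fin m → ℝ :=
  (Zmat A k i).mulVec (paramErr b x i)
    - g.sigma • (∑ j, laplacianMat A i j • sVar g b x j)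
    - g.lam • x.v i - (g.lam / 2) • ownBiasErrRate g muIF A x i

/-- The auxiliary control
`w_i = k v_i - lam (v_i + (1/2) d/dt (b_i - bhat_i^i)) - sigma ∑ j, L_ij s_j - Z_i θhat^i`. -/
def auxControl (g : Gains) (muIF : ℝ) (A : Matrix (Fin n) (Fin n) ℝ) (k : ℝ)
    (b : Fin n → Fin m → ℝ) (x : NetState n m) (i : Fin n) : Fin m → ℝ :=
  k • x.v i - g.lam • (x.v i + (1 / 2 : ℝ) • ownBiasErrRate g muIF A x i)
    - g.sigma • (∑ j, laplacianMat A i j • sVar g b x j)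
    - (Zmat A k i).mulVec (x.θhat i)

/-- The regressor `Y_i = [acc_i, k v_i, (k/2) [Q_{i1} I, …, Q_{in} I]]`, for the acceleration
`acc` of agent `i`. -/
def regressor (A : Matrix (Fin n) (Fin n) ℝ) (k : ℝ) (acc : Fin m → ℝ) (x : NetState n m)
    (i : Fin n) : Matrix (Fin m) (ParamIdx n m) ℝ :=
  Matrix.of fun r => Sum.elim ![acc r, k * x.v i r] fun p =>
    if r = p.2 then (1 / 2) * k * signlessMat A i p.1 else 0

/-- The measurement `z_ij = q_i - q_j + b_i` of the sensor of agent `i`. -/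
def measurement (b : Fin n → Fin m → ℝ) (x : NetState n m) (i j : Fin n) : Fin m → ℝ :=
  x.q i - x.q j + b i

/-- The control is the distributed feedback
`u_i = k (-v_i - (1/2) ∑ j, a_ij (z_ij + z_ji)) + w_i`. -/
theorem controlLaw_eq_distributed (g : Gains) (muIF : ℝ) (A : Matrix (Fin n) (Fin n) ℝ) (k : ℝ)
    (b : Fin n → Fin m → ℝ) (x : NetState n m) (i : Fin n) :
    controlLaw g muIF A k b x i =
      k • (-x.v i - (1 / 2 : ℝ) • ∑ j, A i j • (measurement b x i j + measurement b x j i))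
        + auxControl g muIF A k b x i := by
  have hZ : (Zmat A k i).mulVec (trueParam b) =
      -(k • (1 / 2 : ℝ) • ∑ j, A i j • (measurement b x i j + measurement b x j i)) := by
    funext r
    simp only [Matrix.mulVec, dotProduct, Fintype.sum_sum_type, Fintype.sum_prod_type, Zmat,
      trueParam, measurement, signlessMat, degreeMat, Matrix.of_apply, Sum.elim_inl, Sum.elim_inr,
      Matrix.add_apply, Matrix.diagonal_apply, Pi.neg_apply, Pi.smul_apply, Finset.sum_apply,
      Pi.add_apply, Pi.sub_apply, smul_eq_mul, ite_mul, zero_mul, Finset.sum_ite_eq,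
      Finset.mem_univ, if_true, Finset.sum_const_zero, zero_add, mul_add, add_mul,
      Finset.sum_add_distrib]
    simp only [mul_ite, ite_mul, mul_zero, zero_mul, Finset.sum_ite_eq, Finset.mem_univ, if_true,
      Finset.mul_sum, Finset.sum_mul, ← Finset.sum_add_distrib, ← Finset.sum_neg_distrib]
    refine Finset.sum_congr rfl fun j _ => ?_
    ring
  have hE : (Zmat A k i).mulVec (paramErr b x i) =
      (Zmat A k i).mulVec (trueParam b) - (Zmat A k i).mulVec (x.θhat i) := by
    rw [paramErr, Matrix.mulVec_sub]
  rw [controlLaw, auxControl, hE, hZ]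
  module

end Laws

/-- `x` is absolutely continuous on every `[0, t]` with derivative `f` almost everywhere, in
integrated form. -/
def HasRate (x f : ℝ → ℝ) : Prop :=
  ∀ t, 0 ≤ t → IntervalIntegrable f volume 0 t ∧ x t = x 0 + ∫ τ in (0 : ℝ)..t, f τ

/-- `x` is a (Carathéodory) solution on `[0, ∞)` of the closed loop: double integrators under the
control law, the filters (started at zero), and the adaptation law (arbitrary initial value). -/
structure IsClosedLoopSolution {n m : ℕ} (a : ℝ → Matrix (Fin n) (Fin n) ℝ) (k : ℝ → ℝ)
    (g : Gains) (muIF : ℝ) (b : Fin n → Fin m → ℝ) (x : ℝ → NetState n m) : Prop where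
  position : ∀ i c, HasRate (fun t => (x t).q i c) fun t => (x t).v i c
  velocity : ∀ i c, HasRate (fun t => (x t).v i c) fun t =>
    controlLaw g muIF (a t) (k t) b (x t) i c
  regressorFilter : ∀ i r c, HasRate (fun t => (x t).YF i r c) fun t =>
    -g.beta * (x t).YF i r c +
      regressor (a t) (k t) (controlLaw g muIF (a t) (k t) b (x t) i) (x t) i r c
  controlFilter : ∀ i c, HasRate (fun t => (x t).wF i c) fun t =>
    -g.beta * (x t).wF i c + auxControl g muIF (a t) (k t) b (x t) i c
  regressorIntegral : ∀ i c d, HasRate (fun t => (x t).YIF i c d) fun t =>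
    (((x t).YF i).transpose * (x t).YF i) c d
  controlIntegral : ∀ i c, HasRate (fun t => (x t).wIF i c) fun t =>
    (((x t).YF i).transpose.mulVec ((x t).wF i)) c
  adaptation : ∀ i c, HasRate (fun t => (x t).θhat i c) fun t =>
    adaptRate g muIF (a t) (x t) i c
  YF_zero : ∀ i, (x 0).YF i = 0
  wF_zero : ∀ i, (x 0).wF i = 0
  YIF_zero : ∀ i, (x 0).YIF i = 0
  wIF_zero : ∀ i, (x 0).wIF i = 0

/-! ### Modes of convergence and boundedness -/

/-- `y → 0` exponentially from time `t₁` on. -/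
def ExpConvergesToZero {p : ℕ} (y : ℝ → Fin p → ℝ) (t₁ : ℝ) : Prop :=
  ∃ C α : ℝ, 0 < α ∧ ∀ t, t₁ ≤ t → ‖y t‖ ≤ C * Real.exp (-α * (t - t₁))

/-- `y` is bounded uniformly in `t ≥ 0`. -/
def UniformlyBounded {ι : Type} [Fintype ι] (y : ℝ → ι → ℝ) : Prop :=
  ∃ B : ℝ, ∀ t, 0 ≤ t → ‖y t‖ ≤ B

end

/-! ### Calculus of rates -/

/-! The regressor is built so that the true parameter θ satisfies Y_i θ = w_i. As the filters are
linear and start at zero, this passes to w_F = Y_F θ and w_IF = Y_IF θ, and the adaptation law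
becomes an autonomous-looking equation for the parameter errors: consensus over the graph plus a
leak with the positive semidefinite matrix M_i = μ_F Y_Fᵀ Y_F + μ_IF Y_IF. The total squared error
is therefore nonincreasing. From t₀ + Tbar on, excitation and the monotonicity of Y_IF make the sum
over the agents of the leaks definite, although no single leak need be. Over a window of length T a
small energy loss forces the errors to be nearly equal (joint connectedness) and nearly annihilated
by every leak, hence small; so the energy contracts by a fixed factor per window.

The obstacle is that Y_IF may grow linearly, so the rate of the error is not controlled by the
dissipated energy uniformly in time. `exists_leaky_consensus_contraction` overcomes this by looking
at the errors through the resolvent (1 + P_i)⁻¹ of the leak frozen at the start of the window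
(`exists_resolvent`). The resolvent turns the large leak term into a quantity bounded by the
dissipation, and it displaces the error by no more than that. The contraction constant then does not
depend on the size of P_i.

The rest is a cascade of stable linear equations. The variables s_i follow consensus driven by Z_i
times the parameter error, a decaying input, so their disagreement decays
(`exists_consensus_contraction`, `sVar_sub_expDecay`), their rates decay and they stay bounded. The
adaptation rate decays because exponential decay beats the linear growth of Y_IF. Then v_i' = -λ v_i
plus decaying terms, and q_i - q_j solves a stable first-order equation driven by s_i - s_j and the
bias errors. Boundedness of q_i follows by integrating v_i, that of w_i term by term. -/

namespace HasRate

variable {x y f g : ℝ → ℝ}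

theorem congr (hx : HasRate x f) (h : ∀ t, 0 ≤ t → f t = g t) : HasRate x g := by
  intro t ht
  obtain ⟨h1, h2⟩ := hx t ht
  have he : Set.EqOn f g (Set.uIcc 0 t) := fun s hs => h s (by
    rw [Set.uIcc_of_le ht] at hs; exact hs.1)
  refine ⟨h1.congr ?_, ?_⟩
  · intro s hs
    exact he (Set.uIoc_subset_uIcc hs)
  · rw [h2, intervalIntegral.integral_congr he]

theorem add (hx : HasRate x f) (hy : HasRate y g) :
    HasRate (fun t => x t + y t) fun t => f t + g t := by
  intro t ht
  obtain ⟨h1, h2⟩ := hx t ht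
  obtain ⟨h3, h4⟩ := hy t ht
  refine ⟨h1.add h3, ?_⟩
  beta_reduce
  rw [intervalIntegral.integral_add h1 h3, h2, h4]
  ring

theorem const_mul (hx : HasRate x f) (r : ℝ) : HasRate (fun t => r * x t) fun t => r * f t := by
  intro t ht
  obtain ⟨h1, h2⟩ := hx t ht
  refine ⟨h1.const_mul r, ?_⟩
  beta_reduce
  rw [intervalIntegral.integral_const_mul, h2]
  ring

theorem mul_const (hx : HasRate x f) (r : ℝ) : HasRate (fun t => x t * r) fun t => f t * r := by
  simpa only [mul_comm] using hx.const_mul r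

theorem neg (hx : HasRate x f) : HasRate (fun t => -x t) fun t => -f t := by
  simpa using hx.const_mul (-1)

theorem sub (hx : HasRate x f) (hy : HasRate y g) :
    HasRate (fun t => x t - y t) fun t => f t - g t := by
  simpa only [sub_eq_add_neg] using hx.add hy.neg

theorem const (r : ℝ) : HasRate (fun _ => r) fun _ => 0 := fun t _ => by simp

theorem sum {ι : Type*} (s : Finset ι) {x f : ι → ℝ → ℝ} (h : ∀ i ∈ s, HasRate (x i) (f i)) :
    HasRate (fun t => ∑ i ∈ s, x i t) fun t => ∑ i ∈ s, f i t := by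
  classical
  induction s using Finset.induction_on with
  | empty => simpa using const 0
  | insert i s hi ih =>
    simp only [Finset.sum_insert hi]
    exact (h i (Finset.mem_insert_self i s)).add
      (ih fun j hj => h j (Finset.mem_insert_of_mem hj))

theorem intervalIntegrable (hx : HasRate x f) {s t : ℝ} (hs : 0 ≤ s) (ht : 0 ≤ t) :
    IntervalIntegrable f volume s t :=
  (hx s hs).1.symm.trans (hx t ht).1

theorem sub_eq_integral (hx : HasRate x f) {s t : ℝ} (hs : 0 ≤ s) (ht : 0 ≤ t) :
    x t - x s = ∫ τ in s..t, f τ := by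
  rw [(hx t ht).2, (hx s hs).2, add_sub_add_left_eq_sub,
    intervalIntegral.integral_interval_sub_left (hx t ht).1 (hx s hs).1]

theorem continuousOn_Icc (hx : HasRate x f) {t : ℝ} (ht : 0 ≤ t) :
    ContinuousOn x (Set.Icc 0 t) := by
  have h := intervalIntegral.continuousOn_primitive_interval
    ((intervalIntegrable_iff_integrableOn_Icc_of_le ht).1 (hx t ht).1 |>.mono_set
      (Set.uIcc_of_le ht).subset)
  rw [Set.uIcc_of_le ht] at h
  exact (continuousOn_const.add h).congr fun s hs => (hx s hs.1).2

theorem continuousOn (hx : HasRate x f) : ContinuousOn x (Set.Ici 0) := by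
  intro t ht
  have h := hx.continuousOn_Icc (t := t + 1) (by have : 0 ≤ t := ht; linarith) t
    ⟨ht, by linarith⟩
  refine h.mono_of_mem_nhdsWithin ?_
  rw [mem_nhdsWithin]
  exact ⟨Set.Iio (t + 1), isOpen_Iio, by simp, fun s hs => ⟨hs.2, le_of_lt hs.1⟩⟩

theorem continuousOn_uIcc (hx : HasRate x f) {s t : ℝ} (hs : 0 ≤ s) (ht : 0 ≤ t) :
    ContinuousOn x (Set.uIcc s t) :=
  hx.continuousOn.mono fun r hr => by
    rcases Set.mem_uIcc.1 hr with h | h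
    · exact hs.trans h.1
    · exact ht.trans h.1

/-- This and the next lemma concern the primitive of f instead of x, because `HasRate` leaves x
arbitrary at negative times. The product rule `mul` is then integration by parts for absolutely
continuous functions. -/
theorem absolutelyContinuous (hx : HasRate x f) {t : ℝ} (ht : 0 ≤ t) :
    AbsolutelyContinuousOnInterval (fun s => x 0 + ∫ τ in (0 : ℝ)..s, f τ) 0 t :=
  (contDiffOn_const (c := x 0)).absolutelyContinuousOnInterval.add
    ((hx t ht).1.absolutelyContinuousOnInterval_intervalIntegral (by simp))

theorem ae_hasDerivAt (hx : HasRate x f) {t : ℝ} (ht : 0 ≤ t) :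
    ∀ᵐ s, s ∈ Set.uIcc 0 t → HasDerivAt (fun s => x 0 + ∫ τ in (0 : ℝ)..s, f τ) (f s) s := by
  filter_upwards [(hx t ht).1.ae_hasDerivAt_integral] with s hs h
  simpa using (hs h 0 (by simp)).const_add (x 0)

theorem mul (hx : HasRate x f) (hy : HasRate y g) :
    HasRate (fun t => x t * y t) fun t => f t * y t + x t * g t := by
  intro t ht
  refine ⟨((hx t ht).1.mul_continuousOn (hy.continuousOn_uIcc le_rfl ht)).add
    ((hy t ht).1.continuousOn_mul (hx.continuousOn_uIcc le_rfl ht)), ?_⟩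
  have h := (hx.absolutelyContinuous ht).integral_deriv_mul_eq_sub (hy.absolutelyContinuous ht)
  rw [← (hx t ht).2, ← (hy t ht).2] at h
  simp only [intervalIntegral.integral_same, add_zero] at h
  rw [← sub_eq_iff_eq_add', ← h]
  refine intervalIntegral.integral_congr_ae ?_
  filter_upwards [hx.ae_hasDerivAt ht, hy.ae_hasDerivAt ht] with s h1 h2 hs
  have hs' := Set.uIoc_subset_uIcc hs
  have h0 : 0 ≤ s := by rw [Set.uIcc_of_le ht] at hs'; exact hs'.1
  rw [(h1 hs').deriv, (h2 hs').deriv, ← (hx s h0).2, ← (hy s h0).2]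

theorem of_hasDerivAt (h : ∀ t, HasDerivAt x (f t) t) (hf : Continuous f) : HasRate x f := by
  intro t _
  refine ⟨hf.intervalIntegrable 0 t, ?_⟩
  rw [intervalIntegral.integral_eq_sub_of_hasDerivAt (fun s _ => h s) (hf.intervalIntegrable 0 t)]
  ring

theorem exp_mul (r : ℝ) : HasRate (fun t => Real.exp (r * t)) fun t => r * Real.exp (r * t) := by
  refine of_hasDerivAt (fun t => ?_) (by fun_prop)
  simpa [mul_comm] using ((hasDerivAt_id t).const_mul r).exp

theorem le_of_rate_nonpos (hx : HasRate x f) {s t : ℝ} (hs : 0 ≤ s) (hst : s ≤ t)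
    (hf : ∀ τ, s ≤ τ → τ ≤ t → f τ ≤ 0) : x t ≤ x s := by
  have h := hx.sub_eq_integral hs (hs.trans hst)
  have : ∫ τ in s..t, f τ ≤ ∫ _ in s..t, (0 : ℝ) :=
    intervalIntegral.integral_mono_on hst (hx.intervalIntegrable hs (hs.trans hst)) (by simp)
      fun τ hτ => hf τ hτ.1 hτ.2
  simp at this
  linarith

/-- A solution of `y' = -r y` starting at zero vanishes. -/
theorem eq_zero_of_linear {r : ℝ} (hx : HasRate x f) (h0 : x 0 = 0)
    (hf : ∀ t, 0 ≤ t → f t = -r * x t) {t : ℝ} (ht : 0 ≤ t) : x t = 0 := by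
  have h := (hx.mul (exp_mul r)).congr (g := fun _ => 0) fun s hs => by rw [hf s hs]; ring
  have h2 := h.sub_eq_integral le_rfl ht
  simp [h0] at h2
  exact h2

/-- The square of an increment is controlled by the integral of a majorant of the squared rate. -/
theorem sq_sub_le (hx : HasRate x f) {h : ℝ → ℝ} {s t : ℝ} (hs : 0 ≤ s) (hst : s ≤ t)
    (hh : IntervalIntegrable h volume s t) (hf : ∀ τ, s ≤ τ → τ ≤ t → f τ ^ 2 ≤ h τ) :
    (x t - x s) ^ 2 ≤ (t - s) * ∫ τ in s..t, h τ := by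
  have hfi := hx.intervalIntegrable hs (hs.trans hst)
  rw [hx.sub_eq_integral hs (hs.trans hst)]
  set I := ∫ τ in s..t, f τ
  set H := ∫ τ in s..t, h τ
  -- Cauchy–Schwarz by a nonnegative quadratic in r, minimal at r = I / (t - s). Only the majorant h
  -- has to be integrable, not the square of f.
  have key : ∀ r : ℝ, 0 ≤ r ^ 2 * (t - s) - 2 * r * I + H := by
    intro r
    have h1 : ∫ τ in s..t, (r ^ 2 - 2 * r * f τ + h τ) = r ^ 2 * (t - s) - 2 * r * I + H := by
      rw [intervalIntegral.integral_add ((by simp : IntervalIntegrable (fun _ => r ^ 2)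
        volume s t).sub (hfi.const_mul _)) hh,
        intervalIntegral.integral_sub (by simp) (hfi.const_mul _),
        intervalIntegral.integral_const_mul, intervalIntegral.integral_const, smul_eq_mul]
      ring
    rw [← h1]
    refine intervalIntegral.integral_nonneg hst fun τ hτ => ?_
    nlinarith [hf τ hτ.1 hτ.2, sq_nonneg (r - f τ)]
  have hH : 0 ≤ H := by simpa using key 0
  have hI : 0 ≤ t - s := by linarith
  rcases hI.eq_or_lt with h0 | h0
  · have : s = t := by linarith
    simp [I, this]
  · have := key (I / (t - s))
    have e : (I / (t - s)) ^ 2 * (t - s) - 2 * (I / (t - s)) * I + H = H - I ^ 2 / (t - s) := by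
      field_simp; ring
    rw [e, sub_nonneg, div_le_iff₀ h0] at this
    linarith

end HasRate

/-! ### Exponentially decaying scalar signals -/

/-- `y` decays exponentially from time `t₁` on. -/
def ExpDecay (y : ℝ → ℝ) (t₁ : ℝ) : Prop :=
  ∃ C α : ℝ, 0 < α ∧ ∀ t, t₁ ≤ t → |y t| ≤ C * Real.exp (-α * (t - t₁))

/-- `y` is bounded on `[0, ∞)`. -/
def BddSignal (y : ℝ → ℝ) : Prop := ∃ B : ℝ, ∀ t, 0 ≤ t → |y t| ≤ B

namespace ExpDecay

variable {x y : ℝ → ℝ} {t₁ : ℝ}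

/-- The decay rate may be chosen below any prescribed positive number. -/
theorem exists_rate_le (h : ExpDecay y t₁) {r : ℝ} (hr : 0 < r) :
    ∃ C α : ℝ, 0 ≤ C ∧ 0 < α ∧ α ≤ r ∧ ∀ t, t₁ ≤ t → |y t| ≤ C * Real.exp (-α * (t - t₁)) := by
  obtain ⟨C, α, hα, h⟩ := h
  have hC : 0 ≤ C := by simpa using (abs_nonneg _).trans (h t₁ le_rfl)
  refine ⟨C, min α r, hC, lt_min hα hr, min_le_right _ _, fun t ht => (h t ht).trans ?_⟩
  have : min α r * (t - t₁) ≤ α * (t - t₁) :=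
    mul_le_mul_of_nonneg_right (min_le_left _ _) (by linarith)
  gcongr ?_ * Real.exp ?_
  linarith

theorem mono (h : ExpDecay y t₁) (hxy : ∀ t, t₁ ≤ t → |x t| ≤ |y t|) : ExpDecay x t₁ := by
  obtain ⟨C, α, hα, h⟩ := h
  exact ⟨C, α, hα, fun t ht => (hxy t ht).trans (h t ht)⟩

theorem congr (h : ExpDecay y t₁) (hxy : ∀ t, t₁ ≤ t → y t = x t) : ExpDecay x t₁ :=
  h.mono fun t ht => by rw [hxy t ht]

theorem zero : ExpDecay (fun _ => 0) t₁ := ⟨0, 1, one_pos, fun t _ => by simp⟩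

theorem add (hx : ExpDecay x t₁) (hy : ExpDecay y t₁) : ExpDecay (fun t => x t + y t) t₁ := by
  obtain ⟨C, α, hC, hα, -, h⟩ := hx.exists_rate_le one_pos
  obtain ⟨C', α', hC', hα', hle, h'⟩ := hy.exists_rate_le hα
  refine ⟨C + C', α', hα', fun t ht => ?_⟩
  have h1 : Real.exp (-α * (t - t₁)) ≤ Real.exp (-α' * (t - t₁)) :=
    Real.exp_le_exp.2 (by nlinarith)
  have h2 := mul_le_mul_of_nonneg_left h1 hC
  calc |x t + y t| ≤ |x t| + |y t| := abs_add_le _ _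
    _ ≤ _ := by rw [add_mul]; linarith [h t ht, h' t ht]

theorem bdd_mul {c : ℝ → ℝ} {B : ℝ} (hc : ∀ t, t₁ ≤ t → |c t| ≤ B) (hy : ExpDecay y t₁) :
    ExpDecay (fun t => c t * y t) t₁ := by
  obtain ⟨C, α, hC, hα, -, h⟩ := hy.exists_rate_le one_pos
  refine ⟨B * C, α, hα, fun t ht => ?_⟩
  rw [abs_mul, mul_assoc]
  exact mul_le_mul (hc t ht) (h t ht) (abs_nonneg _) ((abs_nonneg _).trans (hc t ht))

theorem const_mul (hy : ExpDecay y t₁) (r : ℝ) : ExpDecay (fun t => r * y t) t₁ :=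
  hy.bdd_mul (B := |r|) fun _ _ => le_rfl

theorem neg (hy : ExpDecay y t₁) : ExpDecay (fun t => -y t) t₁ := by
  simpa using hy.const_mul (-1)

theorem sub (hx : ExpDecay x t₁) (hy : ExpDecay y t₁) : ExpDecay (fun t => x t - y t) t₁ := by
  simpa only [sub_eq_add_neg] using hx.add hy.neg

theorem sum {ι : Type*} (s : Finset ι) {x : ι → ℝ → ℝ} (h : ∀ i ∈ s, ExpDecay (x i) t₁) :
    ExpDecay (fun t => ∑ i ∈ s, x i t) t₁ := by
  classical
  induction s using Finset.induction_on with
  | empty => simpa using zero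
  | insert i s hi ih =>
    simp only [Finset.sum_insert hi]
    exact (h i (Finset.mem_insert_self i s)).add
      (ih fun j hj => h j (Finset.mem_insert_of_mem hj))

/-- Exponential decay survives multiplication by a signal of at most linear growth. -/
theorem linearGrowth_mul {c : ℝ → ℝ} {B : ℝ} (hc : ∀ t, t₁ ≤ t → |c t| ≤ B * (1 + (t - t₁)))
    (hy : ExpDecay y t₁) : ExpDecay (fun t => c t * y t) t₁ := by
  obtain ⟨C, α, hC, hα, -, h⟩ := hy.exists_rate_le one_pos
  have hB : 0 ≤ B := by simpa using (abs_nonneg _).trans (hc t₁ le_rfl)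
  -- Half of the decay rate pays for the growth: 1 + u ≤ (1 + 2/α) exp(αu/2).
  refine ⟨B * (1 + 2 / α) * C, α / 2, by positivity, fun t ht => ?_⟩
  have hu : 0 ≤ t - t₁ := by linarith
  have h1 : 1 + (t - t₁) ≤ (1 + 2 / α) * Real.exp (α / 2 * (t - t₁)) := by
    have h2 := Real.add_one_le_exp (α / 2 * (t - t₁))
    have h3 : 1 + (t - t₁) ≤ (1 + 2 / α) * (α / 2 * (t - t₁) + 1) := by
      have : (1 + 2 / α) * (α / 2 * (t - t₁) + 1)
          = 1 + (t - t₁) + (α / 2 * (t - t₁) + 2 / α) := by field_simp; ring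
      rw [this]
      have : 0 ≤ α / 2 * (t - t₁) + 2 / α := by positivity
      linarith
    exact h3.trans (mul_le_mul_of_nonneg_left h2 (by positivity))
  have e : Real.exp (-(α / 2) * (t - t₁))
      = Real.exp (α / 2 * (t - t₁)) * Real.exp (-α * (t - t₁)) := by
    rw [← Real.exp_add]; ring_nf
  rw [abs_mul, e]
  calc |c t| * |y t| ≤ (B * ((1 + 2 / α) * Real.exp (α / 2 * (t - t₁)))) *
        (C * Real.exp (-α * (t - t₁))) :=
        mul_le_mul ((hc t ht).trans (mul_le_mul_of_nonneg_left h1 hB)) (h t ht)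
          (abs_nonneg _) (by positivity)
    _ = _ := by ring

theorem of_sq (h : ExpDecay (fun t => y t ^ 2) t₁) : ExpDecay y t₁ := by
  obtain ⟨C, α, hα, h⟩ := h
  have hC : 0 ≤ C := by simpa using (abs_nonneg _).trans (h t₁ le_rfl)
  refine ⟨Real.sqrt C, α / 2, by positivity, fun t ht => ?_⟩
  refine abs_le_of_sq_le_sq ?_ (by positivity)
  have e : Real.exp (-(α / 2) * (t - t₁)) ^ 2 = Real.exp (-α * (t - t₁)) := by
    rw [← Real.exp_nat_mul]; ring_nf
  rw [mul_pow, Real.sq_sqrt hC, e]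
  exact (le_abs_self _).trans (h t ht)

/-- A nonnegative signal that contracts over windows of fixed length, up to an exponentially small
error, decays exponentially. -/
theorem of_window_contraction {T ρ Q α B : ℝ} (hT : 0 < T) (hρ : 0 ≤ ρ) (hρ1 : ρ < 1)
    (hα : 0 < α) (hy0 : ∀ t, t₁ ≤ t → 0 ≤ y t) (hB : ∀ t, t₁ ≤ t → t ≤ t₁ + T → y t ≤ B)
    (h : ∀ t, t₁ ≤ t → y (t + T) ≤ ρ * y t + Q * Real.exp (-α * (t - t₁))) :
    ExpDecay y t₁ := by
  -- The rate β must be slow enough that the factor ρ exp(βT) stays below 1. Aiming at exp(βT) ≤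
  -- 2/(1 + ρ) achieves this and also covers ρ = 0.
  obtain ⟨β, hβ, hβα, hβρ⟩ : ∃ β : ℝ, 0 < β ∧ β ≤ α ∧ ρ * Real.exp (β * T) < 1 := by
    have hl : 0 < -Real.log ((1 + ρ) / 2) := by
      rw [Left.neg_pos_iff]; exact Real.log_neg (by linarith) (by linarith)
    refine ⟨min α (-Real.log ((1 + ρ) / 2) / T), lt_min hα (by positivity), min_le_left _ _, ?_⟩
    have h1 : min α (-Real.log ((1 + ρ) / 2) / T) * T ≤ -Real.log ((1 + ρ) / 2) :=
      (mul_le_mul_of_nonneg_right (min_le_right _ _) hT.le).trans_eq (by field_simp)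
    have h2 := Real.exp_le_exp.2 h1
    rw [Real.exp_neg, Real.exp_log (by linarith)] at h2
    calc _ ≤ ρ * ((1 + ρ) / 2)⁻¹ := mul_le_mul_of_nonneg_left h2 hρ
      _ < 1 := by rw [← div_eq_mul_inv, div_lt_one (by linarith)]; linarith
  set r := ρ * Real.exp (β * T)
  have hr : 0 < 1 - r := by linarith
  have hB0 : 0 ≤ B := (hy0 t₁ le_rfl).trans (hB t₁ le_rfl (by linarith))
  -- The first entry bounds the weighted signal y exp(β(t - t₁)) on the first window; the second
  -- gives r M + |Q| exp(βT) ≤ M, so the bound passes from each window to the next.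
  set M := max (B * Real.exp (β * T)) (|Q| * Real.exp (β * T) / (1 - r))
  have hM : ∀ k : ℕ, ∀ t, t₁ ≤ t → t ≤ t₁ + (k + 1 : ℕ) * T →
      y t * Real.exp (β * (t - t₁)) ≤ M := by
    intro k
    induction k with
    | zero =>
      intro t h1 h2
      refine le_max_of_le_left (mul_le_mul (hB t h1 (by simpa using h2))
        (Real.exp_le_exp.2 (mul_le_mul_of_nonneg_left ?_ hβ.le)) (Real.exp_nonneg _) hB0)
      simp at h2
      linarith
    | succ k ih =>
      intro t h1 h2
      rcases le_total t (t₁ + (k + 1 : ℕ) * T) with h3 | h3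
      · exact ih t h1 h3
      have hkT : 0 ≤ (k : ℝ) * T := by positivity
      push_cast at h2 h3
      have h4 : t₁ ≤ t - T := by nlinarith
      have h5 := ih (t - T) h4 (by push_cast; linarith)
      have h6 := h (t - T) h4
      rw [sub_add_cancel] at h6
      have h7 := mul_le_mul_of_nonneg_right h6 (Real.exp_nonneg (β * (t - t₁)))
      have e1 : Real.exp (β * (t - t₁)) = Real.exp (β * T) * Real.exp (β * (t - T - t₁)) := by
        rw [← Real.exp_add]; ring_nf
      have h8 : Real.exp (-α * (t - T - t₁)) * Real.exp (β * (t - T - t₁)) ≤ 1 := by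
        rw [← Real.exp_add]
        exact Real.exp_le_one_iff.2 (by nlinarith)
      have h9 : Q * (Real.exp (-α * (t - T - t₁)) * Real.exp (β * (t - T - t₁))) ≤ |Q| :=
        (mul_le_mul_of_nonneg_right (le_abs_self Q) (by positivity)).trans
          (mul_le_of_le_one_right (abs_nonneg _) h8)
      have h10 : |Q| * Real.exp (β * T) ≤ M * (1 - r) :=
        (div_le_iff₀ hr).1 (le_max_right _ _)
      have hr0 : 0 ≤ r := by positivity
      calc _ ≤ _ := h7
        _ = r * (y (t - T) * Real.exp (β * (t - T - t₁))) + Real.exp (β * T) *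
            (Q * (Real.exp (-α * (t - T - t₁)) * Real.exp (β * (t - T - t₁)))) := by
          rw [e1]; ring
        _ ≤ r * M + Real.exp (β * T) * |Q| :=
          add_le_add (mul_le_mul_of_nonneg_left h5 hr0)
            (mul_le_mul_of_nonneg_left h9 (Real.exp_nonneg _))
        _ ≤ M := by linarith
  refine ⟨M, β, hβ, fun t ht => ?_⟩
  obtain ⟨k, hk⟩ := exists_nat_ge ((t - t₁) / T)
  have h1 := hM k t ht (by
    have := (div_le_iff₀ hT).1 hk
    push_cast
    linarith)
  rw [abs_of_nonneg (hy0 t ht), neg_mul, Real.exp_neg, ← div_eq_mul_inv,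
    le_div_iff₀ (Real.exp_pos _)]
  exact h1

/-- A stable scalar linear equation with exponentially decaying input. -/
theorem of_linear {r : ℝ} {f d : ℝ → ℝ} (hr : 0 < r) (ht₁ : 0 ≤ t₁) (hy : HasRate y f)
    (hf : ∀ t, t₁ ≤ t → f t = -r * y t + d t) (hd : ExpDecay d t₁) : ExpDecay y t₁ := by
  -- Capping the input rate at r/2 avoids resonance: with the integrating factor exp(rt) the input
  -- integrates to a multiple of exp((r - α)t), with r - α positive.
  obtain ⟨C, α, hC, hα, hαr, h⟩ := hd.exists_rate_le (half_pos hr)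
  have hz := hy.mul (HasRate.exp_mul r)
  have hw := HasRate.exp_mul (r - α)
  refine ⟨|y t₁| + C / (r - α), α, hα, fun t ht => ?_⟩
  have ht0 := ht₁.trans ht
  have hrα : 0 < r - α := by linarith
  have key : |∫ τ in t₁..t, (f τ * Real.exp (r * τ) + y τ * (r * Real.exp (r * τ)))| ≤
      ∫ τ in t₁..t, C * Real.exp (α * t₁) / (r - α) * ((r - α) * Real.exp ((r - α) * τ)) := by
    rw [← Real.norm_eq_abs]
    refine intervalIntegral.norm_integral_le_of_norm_le ht (Filter.Eventually.of_forall
      fun τ hτ => ?_) ((hw.intervalIntegrable ht₁ ht0).const_mul _)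
    rw [hf τ hτ.1.le]
    have e : (-r * y τ + d τ) * Real.exp (r * τ) + y τ * (r * Real.exp (r * τ))
      = d τ * Real.exp (r * τ) := by ring
    rw [e, Real.norm_eq_abs, abs_mul, abs_of_pos (Real.exp_pos _)]
    have e2 : C * Real.exp (α * t₁) / (r - α) * ((r - α) * Real.exp ((r - α) * τ))
        = C * Real.exp (-α * (τ - t₁)) * Real.exp (r * τ) := by
      have : Real.exp (-α * (τ - t₁)) * Real.exp (r * τ) =
          Real.exp (α * t₁) * Real.exp ((r - α) * τ) := by
        rw [← Real.exp_add, ← Real.exp_add]; ring_nf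
      rw [mul_assoc C, this]; field_simp
    rw [e2]
    exact mul_le_mul_of_nonneg_right (h τ hτ.1.le) (Real.exp_nonneg _)
  rw [← hz.sub_eq_integral ht₁ ht0, intervalIntegral.integral_const_mul,
    ← hw.sub_eq_integral ht₁ ht0] at key
  have h1 : |y t * Real.exp (r * t)| ≤ |y t₁ * Real.exp (r * t₁)| +
      C * Real.exp (α * t₁) / (r - α) * Real.exp ((r - α) * t) := by
    have h2 := abs_sub_abs_le_abs_sub (y t * Real.exp (r * t)) (y t₁ * Real.exp (r * t₁))
    have h3 : 0 ≤ C * Real.exp (α * t₁) / (r - α) * Real.exp ((r - α) * t₁) := by positivity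
    rw [mul_sub] at key
    linarith
  rw [abs_mul, abs_mul, abs_of_pos (Real.exp_pos _), abs_of_pos (Real.exp_pos _)] at h1
  have h4 : Real.exp (r * t₁) ≤ Real.exp (-α * (t - t₁)) * Real.exp (r * t) := by
    rw [← Real.exp_add]; exact Real.exp_le_exp.2 (by nlinarith)
  have e3 : Real.exp (-α * (t - t₁)) * Real.exp (r * t) =
      Real.exp (α * t₁) * Real.exp ((r - α) * t) := by
    rw [← Real.exp_add, ← Real.exp_add]; ring_nf
  refine le_of_mul_le_mul_right ?_ (Real.exp_pos (r * t))
  rw [mul_assoc, e3, add_mul]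
  rw [e3] at h4
  have h5 := mul_le_mul_of_nonneg_left h4 (abs_nonneg (y t₁))
  have e4 : C * Real.exp (α * t₁) / (r - α) * Real.exp ((r - α) * t)
    = C / (r - α) * (Real.exp (α * t₁) * Real.exp ((r - α) * t)) := by ring
  linarith

end ExpDecay

/-! ### Bounded scalar signals -/

namespace BddSignal

variable {x y : ℝ → ℝ}

theorem congr (h : BddSignal y) (hxy : ∀ t, 0 ≤ t → y t = x t) : BddSignal x := by
  obtain ⟨B, h⟩ := h
  exact ⟨B, fun t ht => hxy t ht ▸ h t ht⟩

theorem mul (hx : BddSignal x) (hy : BddSignal y) : BddSignal fun t => x t * y t := by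
  obtain ⟨B, h⟩ := hx
  obtain ⟨B', h'⟩ := hy
  refine ⟨B * B', fun t ht => ?_⟩
  rw [abs_mul]
  exact mul_le_mul (h t ht) (h' t ht) (abs_nonneg _) ((abs_nonneg _).trans (h t ht))

theorem add (hx : BddSignal x) (hy : BddSignal y) : BddSignal fun t => x t + y t := by
  obtain ⟨B, h⟩ := hx
  obtain ⟨B', h'⟩ := hy
  exact ⟨B + B', fun t ht => (abs_add_le _ _).trans (add_le_add (h t ht) (h' t ht))⟩

theorem const (r : ℝ) : BddSignal fun _ => r := ⟨|r|, fun _ _ => le_rfl⟩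

theorem const_mul (hx : BddSignal x) (r : ℝ) : BddSignal fun t => r * x t := (const r).mul hx

theorem neg (hx : BddSignal x) : BddSignal fun t => -x t := by simpa using hx.const_mul (-1)

theorem sub (hx : BddSignal x) (hy : BddSignal y) : BddSignal fun t => x t - y t := by
  simpa only [sub_eq_add_neg] using hx.add hy.neg

theorem sum {ι : Type*} (s : Finset ι) {x : ι → ℝ → ℝ} (h : ∀ i ∈ s, BddSignal (x i)) :
    BddSignal fun t => ∑ i ∈ s, x i t := by
  classical
  induction s using Finset.induction_on with
  | empty => simpa using const 0
  | insert i s hi ih =>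
    simp only [Finset.sum_insert hi]
    exact (h i (Finset.mem_insert_self i s)).add
      (ih fun j hj => h j (Finset.mem_insert_of_mem hj))

theorem of_continuousOn {B t₁ : ℝ} (hc : ContinuousOn y (Set.Ici 0))
    (h : ∀ t, t₁ ≤ t → |y t| ≤ B) : BddSignal y := by
  obtain ⟨B', hB'⟩ := isCompact_Icc.exists_bound_of_continuousOn
    (hc.mono (Set.Icc_subset_Ici_self : Set.Icc 0 t₁ ⊆ _))
  refine ⟨max B B', fun t ht => ?_⟩
  rcases le_total t₁ t with h1 | h1
  · exact le_max_of_le_left (h t h1)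
  · exact le_max_of_le_right (hB' t ⟨ht, h1⟩)

theorem of_expDecay {t₁ : ℝ} (hc : ContinuousOn y (Set.Ici 0)) (h : ExpDecay y t₁) :
    BddSignal y := by
  obtain ⟨C, α, hC, hα, -, h⟩ := h.exists_rate_le one_pos
  refine of_continuousOn hc (B := C) fun t ht => (h t ht).trans ?_
  exact mul_le_of_le_one_right hC (Real.exp_le_one_iff.2 (by nlinarith))

/-- A signal with exponentially decaying rate is bounded. -/
theorem of_rate_expDecay {f : ℝ → ℝ} {t₁ : ℝ} (ht₁ : 0 ≤ t₁) (hy : HasRate y f)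
    (h : ExpDecay f t₁) : BddSignal y := by
  obtain ⟨C, α, hC, hα, -, h⟩ := h.exists_rate_le one_pos
  have hw := HasRate.exp_mul (-α)
  refine of_continuousOn hy.continuousOn (B := |y t₁| + C / α) (t₁ := t₁) fun t ht => ?_
  have ht0 := ht₁.trans ht
  have key : |∫ τ in t₁..t, f τ| ≤
      ∫ τ in t₁..t, -(C * Real.exp (α * t₁) / α) * (-α * Real.exp (-α * τ)) := by
    rw [← Real.norm_eq_abs]
    refine intervalIntegral.norm_integral_le_of_norm_le ht (Filter.Eventually.of_forall
      fun τ hτ => (h τ hτ.1.le).trans_eq ?_) ((hw.intervalIntegrable ht₁ ht0).const_mul _)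
    have : Real.exp (-α * (τ - t₁)) = Real.exp (α * t₁) * Real.exp (-α * τ) := by
      rw [← Real.exp_add]; ring_nf
    rw [this]; field_simp
  rw [← hy.sub_eq_integral ht₁ ht0, intervalIntegral.integral_const_mul,
    ← hw.sub_eq_integral ht₁ ht0] at key
  have e : Real.exp (α * t₁) * Real.exp (-α * t₁) = 1 := by
    rw [← Real.exp_add]; simp
  have e2 : -(C * Real.exp (α * t₁) / α) * (Real.exp (-α * t) - Real.exp (-α * t₁)) =
      C / α * (Real.exp (α * t₁) * Real.exp (-α * t₁))
        - C * Real.exp (α * t₁) / α * Real.exp (-α * t) := by ring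
  rw [e2, e] at key
  have h3 : 0 ≤ C * Real.exp (α * t₁) / α * Real.exp (-α * t) := by positivity
  linarith [abs_sub_abs_le_abs_sub (y t) (y t₁)]

end BddSignal

/-! ### Consensus over jointly connected graphs -/

section Weights

variable {n : ℕ}

theorem laplacian_energy {w : Fin n → Fin n → ℝ} (hw : ∀ i j, w i j = w j i) (z : Fin n → ℝ) :
    ∑ i, z i * ∑ j, w i j * (z i - z j) = 1 / 2 * ∑ i, ∑ j, w i j * (z i - z j) ^ 2 := by
  have h1 : ∑ i, z i * ∑ j, w i j * (z i - z j) = ∑ i, ∑ j, w i j * (z i * (z i - z j)) := by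
    refine Finset.sum_congr rfl fun i _ => ?_
    rw [Finset.mul_sum]
    exact Finset.sum_congr rfl fun j _ => by ring
  have h2 : ∑ i, ∑ j, w i j * (z i * (z i - z j)) = ∑ i, ∑ j, w i j * (z j * (z j - z i)) := by
    rw [Finset.sum_comm]
    exact Finset.sum_congr rfl fun i _ => Finset.sum_congr rfl fun j _ => by rw [hw]
  have h3 : ∑ i, ∑ j, w i j * (z i - z j) ^ 2 =
      ∑ i, ∑ j, w i j * (z i * (z i - z j)) + ∑ i, ∑ j, w i j * (z j * (z j - z i)) := by
    simp only [← Finset.sum_add_distrib]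
    exact Finset.sum_congr rfl fun i _ => Finset.sum_congr rfl fun j _ => by ring
  rw [h1, h3, ← h2]
  ring

/-- Antisymmetry of the summand under exchange of i and j. It makes the mean of a consensus system
move with the mean input only. -/
theorem laplacian_sum_eq_zero {w : Fin n → Fin n → ℝ} (hw : ∀ i j, w i j = w j i)
    (z : Fin n → ℝ) : ∑ i, ∑ j, w i j * (z i - z j) = 0 := by
  have h2 : ∑ i, ∑ j, w i j * (z i - z j) = ∑ i, ∑ j, w i j * (z j - z i) := by
    rw [Finset.sum_comm]
    exact Finset.sum_congr rfl fun i _ => Finset.sum_congr rfl fun j _ => by rw [hw]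
  have h3 : ∑ i, ∑ j, w i j * (z i - z j) = -∑ i, ∑ j, w i j * (z j - z i) := by
    simp only [← Finset.sum_neg_distrib]
    exact Finset.sum_congr rfl fun i _ => Finset.sum_congr rfl fun j _ => by ring
  linarith

/-- Cauchy–Schwarz together with w² ≤ aM w. The point is that the squared speed of consensus is
bounded by the very energy it dissipates, so little dissipation means little motion. -/
theorem laplacian_sq_le {w : Fin n → Fin n → ℝ} {aM : ℝ} (h0 : ∀ i j, 0 ≤ w i j)
    (hM : ∀ i j, w i j ≤ aM) (z : Fin n → ℝ) (i : Fin n) :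
    (∑ j, w i j * (z i - z j)) ^ 2 ≤ n * aM * ∑ i, ∑ j, w i j * (z i - z j) ^ 2 := by
  have h1 : (∑ j, w i j * (z i - z j)) ^ 2 ≤ n * ∑ j, (w i j * (z i - z j)) ^ 2 := by
    simpa using sq_sum_le_card_mul_sum_sq (s := Finset.univ) (f := fun j => w i j * (z i - z j))
  have h2 : ∑ j, (w i j * (z i - z j)) ^ 2 ≤ aM * ∑ j, w i j * (z i - z j) ^ 2 := by
    rw [Finset.mul_sum]
    refine Finset.sum_le_sum fun j _ => ?_
    have := mul_le_mul_of_nonneg_right (hM i j) (mul_nonneg (h0 i j) (sq_nonneg (z i - z j)))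
    calc _ = w i j * (w i j * (z i - z j) ^ 2) := by ring
      _ ≤ _ := this
  have h3 : ∑ j, w i j * (z i - z j) ^ 2 ≤ ∑ i, ∑ j, w i j * (z i - z j) ^ 2 :=
    Finset.single_le_sum (f := fun i => ∑ j, w i j * (z i - z j) ^ 2)
      (fun i _ => Finset.sum_nonneg fun j _ => mul_nonneg (h0 i j) (sq_nonneg _))
      (Finset.mem_univ i)
  have haM : 0 ≤ aM := (h0 i i).trans (hM i i)
  calc _ ≤ _ := h1
    _ ≤ n * (aM * ∑ i, ∑ j, w i j * (z i - z j) ^ 2) :=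
      mul_le_mul_of_nonneg_left (h2.trans (mul_le_mul_of_nonneg_left h3 haM)) (by positivity)
    _ = _ := by ring

theorem edge_energy_le {w : Fin n → Fin n → ℝ} (h0 : ∀ i j, 0 ≤ w i j) (z : Fin n → ℝ)
    (i j : Fin n) : w i j * (z i - z j) ^ 2 ≤ ∑ i, ∑ j, w i j * (z i - z j) ^ 2 :=
  (Finset.single_le_sum (f := fun j => w i j * (z i - z j) ^ 2)
    (fun j _ => mul_nonneg (h0 i j) (sq_nonneg _)) (Finset.mem_univ j)).trans
  (Finset.single_le_sum (f := fun i => ∑ j, w i j * (z i - z j) ^ 2)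
      (fun i _ => Finset.sum_nonneg fun j _ => mul_nonneg (h0 i j) (sq_nonneg _))
      (Finset.mem_univ i))

/-- Triangle inequality for the square roots along a simple path, which has fewer than n edges. -/
theorem sq_sub_le_of_connected {G : SimpleGraph (Fin n)} (hG : G.Connected) {y : Fin n → ℝ}
    {r : ℝ} (hr : 0 ≤ r) (h : ∀ i j, G.Adj i j → (y i - y j) ^ 2 ≤ r) (i j : Fin n) :
    (y i - y j) ^ 2 ≤ n ^ 2 * r := by
  have hw : ∀ {u v : Fin n} (p : G.Walk u v), |y u - y v| ≤ p.length * Real.sqrt r := by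
    intro u v p
    induction p with
    | nil => simp
    | cons hadj p ih =>
      rename_i u' v' w'
      have h1 : |y u' - y v'| ≤ Real.sqrt r := Real.abs_le_sqrt (h _ _ hadj)
      have h2 := abs_sub_le (y u') (y v') (y w')
      simp only [SimpleGraph.Walk.length_cons]
      push_cast
      linarith
  obtain ⟨p, hp⟩ := (hG.preconnected i j).exists_isPath
  have h1 := hw p
  have h2 : (p.length : ℝ) ≤ n := by exact_mod_cast (hp.length_lt.le.trans_eq (by simp))
  have h3 : |y i - y j| ≤ n * Real.sqrt r :=
    h1.trans (mul_le_mul_of_nonneg_right h2 (Real.sqrt_nonneg _))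
  calc (y i - y j) ^ 2 = |y i - y j| ^ 2 := (sq_abs _).symm
    _ ≤ (n * Real.sqrt r) ^ 2 := pow_le_pow_left₀ (abs_nonneg _) h3 2
    _ = _ := by rw [mul_pow, Real.sq_sqrt hr]

end Weights

/-! ### Energy estimates over one connectivity window -/

section Window

variable {n : ℕ} {a : ℝ → Matrix (Fin n) (Fin n) ℝ} {aM δ T : ℝ}

theorem IsUndirectedNetwork.intervalIntegrable (ha : IsUndirectedNetwork a aM) (i j : Fin n)
    {s t : ℝ} (hs : 0 ≤ s) (hst : s ≤ t) :
    IntervalIntegrable (fun τ => a τ i j) volume s t := by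
  rw [intervalIntegrable_iff_integrableOn_Ioc_of_le hst]
  have hsub : Set.Ioc s t ⊆ Set.Ici 0 := fun r hr => hs.trans hr.1.le
  refine Integrable.of_bound
    ((ha.measurable i j).mono_measure (Measure.restrict_mono hsub le_rfl)).aestronglyMeasurable
    aM ?_
  refine (ae_restrict_iff' measurableSet_Ioc).2 (Filter.Eventually.of_forall fun r hr => ?_)
  rw [Real.norm_eq_abs, abs_of_nonneg (ha.nonneg r (hsub hr) i j)]
  exact ha.bounded r (hsub hr) i j

/-- If the disagreement of `x` along the edges has small weighted energy over a window on which
the graph is jointly connected, and `x` stays close to the constant `y`, then the entries of `y`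
nearly agree. -/
theorem consensus_spread (ha : IsUndirectedNetwork a aM) (hδ : 0 < δ) (hT : 0 < T)
    {t : ℝ} (ht : 0 ≤ t) (hconn : (jointGraph a δ T t).Connected) {x : ℝ → Fin n → ℝ}
    {y : Fin n → ℝ} {g e : ℝ → ℝ} (hg : IntervalIntegrable g volume t (t + T))
    (he : IntervalIntegrable e volume t (t + T))
    (hxg : ∀ τ ∈ Set.Icc t (t + T), ∀ i j, a τ i j * (x τ i - x τ j) ^ 2 ≤ g τ)
    (hxe : ∀ τ ∈ Set.Icc t (t + T), ∀ i, (x τ i - y i) ^ 2 ≤ e τ) (i j : Fin n) :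
    (y i - y j) ^ 2 ≤ n ^ 2 * ((2 * (∫ τ in t..(t + T), g τ)
      + 8 * aM * ∫ τ in t..(t + T), e τ) / δ) := by
  have hle : t ≤ t + T := by linarith
  have haM : 0 ≤ aM := (ha.nonneg t ht i i).trans (ha.bounded t ht i i)
  have hedge : ∀ i j, δ ≤ ∫ τ in t..(t + T), a τ i j → (y i - y j) ^ 2 ≤
      (2 * (∫ τ in t..(t + T), g τ) + 8 * aM * ∫ τ in t..(t + T), e τ) / δ := by
    intro i j hij
    rw [le_div_iff₀ hδ]
    have h1 : ∫ τ in t..(t + T), a τ i j * (y i - y j) ^ 2 ≤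
        ∫ τ in t..(t + T), (2 * g τ + 8 * aM * e τ) := by
      refine intervalIntegral.integral_mono_on hle
        ((ha.intervalIntegrable i j ht hle).mul_const _)
        ((hg.const_mul 2).add (he.const_mul _)) fun τ hτ => ?_
      have hτ0 : 0 ≤ τ := ht.trans hτ.1
      have h0 := ha.nonneg τ hτ0 i j
      have hM := ha.bounded τ hτ0 i j
      have hg' := hxg τ hτ i j
      have hi := hxe τ hτ i
      have hj := hxe τ hτ j
      -- Replacing y by x costs the two displacements, each with square at most e.
      have h2 : (y i - y j) ^ 2 ≤ 2 * (x τ i - x τ j) ^ 2 + 8 * e τ := by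
        nlinarith [sq_nonneg ((x τ i - x τ j) + ((x τ i - y i) - (x τ j - y j))),
          sq_nonneg ((x τ i - y i) + (x τ j - y j))]
      have he0 : 0 ≤ e τ := (sq_nonneg _).trans hi
      calc a τ i j * (y i - y j) ^ 2 ≤ a τ i j * (2 * (x τ i - x τ j) ^ 2 + 8 * e τ) :=
            mul_le_mul_of_nonneg_left h2 h0
        _ ≤ 2 * g τ + 8 * aM * e τ := by nlinarith [mul_le_mul_of_nonneg_right hM he0]
    rw [intervalIntegral.integral_mul_const, intervalIntegral.integral_add (hg.const_mul 2)
      (he.const_mul _), intervalIntegral.integral_const_mul,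
      intervalIntegral.integral_const_mul] at h1
    calc _ = δ * (y i - y j) ^ 2 := mul_comm _ _
      _ ≤ _ := mul_le_mul_of_nonneg_right hij (sq_nonneg _)
      _ ≤ _ := h1
  have hg0 : 0 ≤ ∫ τ in t..(t + T), g τ := intervalIntegral.integral_nonneg hle fun τ hτ =>
    (mul_nonneg (ha.nonneg τ (ht.trans hτ.1) i i) (sq_nonneg _)).trans (hxg τ hτ i i)
  have he0 : 0 ≤ ∫ τ in t..(t + T), e τ := intervalIntegral.integral_nonneg hle fun τ hτ =>
    (sq_nonneg _).trans (hxe τ hτ i)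
  refine sq_sub_le_of_connected hconn (by positivity) (fun i j hadj => ?_) i j
  rw [jointGraph, SimpleGraph.fromRel_adj] at hadj
  rcases hadj.2 with h | h
  · exact hedge i j h
  · rw [← neg_sub, neg_sq]
    exact hedge j i h

theorem IsUndirectedNetwork.intervalIntegrable_energy (ha : IsUndirectedNetwork a aM)
    {x : ℝ → Fin n → ℝ} (hx : ∀ i, ContinuousOn (fun τ => x τ i) (Set.Ici 0)) {s t : ℝ}
    (hs : 0 ≤ s) (hst : s ≤ t) :
    IntervalIntegrable (fun τ => ∑ i, ∑ j, a τ i j * (x τ i - x τ j) ^ 2) volume s t := by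
  have hsub : Set.uIcc s t ⊆ Set.Ici 0 := by
    rw [Set.uIcc_of_le hst]; exact fun r hr => hs.trans hr.1
  have h : ∀ i ∈ Finset.univ, ∀ j ∈ Finset.univ,
      IntervalIntegrable (fun τ => a τ i j * (x τ i - x τ j) ^ 2) volume s t := fun i _ j _ =>
    (ha.intervalIntegrable i j hs hst).mul_continuousOn
      ((((hx i).sub (hx j)).pow 2).mono hsub)
  have := IntervalIntegrable.sum Finset.univ fun i hi => IntervalIntegrable.sum Finset.univ (h i hi)
  simpa [Finset.sum_fn] using this

/-- Consensus dynamics with mean-free state: contraction over one window, up to the input. -/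
theorem exists_consensus_contraction (ha : IsUndirectedNetwork a aM) (hδ : 0 < δ) (hT : 0 < T)
    (hconn : IsJointlyConnected a δ T) {σ : ℝ} (hσ : 0 < σ) :
    ∃ ρ C : ℝ, 0 ≤ ρ ∧ ρ < 1 ∧ 0 ≤ C ∧ ∀ (e d : ℝ → Fin n → ℝ) (t η : ℝ), 0 ≤ t →
      (∀ i, HasRate (fun τ => e τ i)
        fun τ => -σ * (∑ j, a τ i j * (e τ i - e τ j)) + d τ i) →
      (∀ τ, 0 ≤ τ → ∑ i, e τ i = 0) →
      (∀ τ ∈ Set.Icc t (t + T), ∀ i, d τ i ^ 2 ≤ η) →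
      ∑ i, e (t + T) i ^ 2 ≤ ρ * ∑ i, e t i ^ 2 + C * η := by
  obtain ⟨i₀⟩ := (hconn 0 le_rfl).nonempty
  have haM : 0 ≤ aM := (ha.nonneg 0 le_rfl i₀ i₀).trans (ha.bounded 0 le_rfl i₀ i₀)
  have hn : (0 : ℝ) < n := by exact_mod_cast i₀.pos
  -- With H the disagreement energy over the window, c₁ H + c₂ η bounds the squared displacement of
  -- each entry, and b₁ H + b₂ η bounds the initial energy V. The summand 1 + σ in b₁ is there for
  -- b₁ > 0 and σ ≤ b₁, hence ρ ≥ 0.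
  obtain ⟨c₁, hc₁⟩ : ∃ c, c = 2 * T * σ ^ 2 * n * aM := ⟨_, rfl⟩
  obtain ⟨c₂, hc₂⟩ : ∃ c, c = 2 * T ^ 2 := ⟨_, rfl⟩
  obtain ⟨b₁, hb₁⟩ : ∃ c, c = n ^ 3 * (2 + 8 * aM * T * c₁) / δ + 1 + σ := ⟨_, rfl⟩
  obtain ⟨b₂, hb₂⟩ : ∃ c, c = n ^ 3 * (8 * aM * T * c₂) / δ := ⟨_, rfl⟩
  -- Young parameter for the input term: its contribution uses up at most half of the dissipation σ
  -- H, and at most half of the decrease of V that the other half of σ H provides.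
  obtain ⟨ε, hε⟩ : ∃ c, c = σ / (4 * n * T * c₁ + 8 * T * b₁) := ⟨_, rfl⟩
  have hc₁0 : 0 ≤ c₁ := by rw [hc₁]; positivity
  have hc₂0 : 0 ≤ c₂ := by rw [hc₂]; positivity
  have hb₁0 : 0 < b₁ := by rw [hb₁]; positivity
  have hb₁σ : σ ≤ b₁ := by rw [hb₁, le_add_iff_nonneg_left]; positivity
  have hb₂0 : 0 ≤ b₂ := by rw [hb₂]; positivity
  have hε0 : 0 < ε := by rw [hε]; positivity
  have hε' : ε * (4 * n * T * c₁ + 8 * T * b₁) = σ := by rw [hε]; field_simp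
  have hε₁ : 2 * n * T * ε * c₁ ≤ σ / 2 := by
    have : 0 ≤ ε * (8 * T * b₁) := by positivity
    nlinarith
  have hε₂ : 2 * ε * T ≤ σ / (4 * b₁) := by
    rw [le_div_iff₀ (by positivity)]
    have : 0 ≤ ε * (4 * n * T * c₁) := by positivity
    nlinarith
  refine ⟨1 - σ / (4 * b₁), σ * b₂ / (2 * b₁) + 2 * n * T * ε * c₂ + n * T / ε, ?_, ?_,
    by positivity, fun e d t η ht he h0 hd => ?_⟩
  · rw [sub_nonneg, div_le_one (by positivity)]; linarith
  · have : 0 < σ / (4 * b₁) := by positivity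
    linarith
  have hle : t ≤ t + T := by linarith
  have hη : 0 ≤ η := (sq_nonneg _).trans (hd t ⟨le_rfl, hle⟩ i₀)
  obtain ⟨E, hE⟩ : ∃ E : ℝ → ℝ, E = fun τ => ∑ i, ∑ j, a τ i j * (e τ i - e τ j) ^ 2 := ⟨_, rfl⟩
  have hE0 : ∀ τ, 0 ≤ τ → 0 ≤ E τ := fun τ hτ => by
    rw [hE]
    exact Finset.sum_nonneg fun i _ => Finset.sum_nonneg fun j _ =>
      mul_nonneg (ha.nonneg τ hτ i j) (sq_nonneg _)
  have hEi : ∀ s, t ≤ s → IntervalIntegrable E volume t s := fun s hs => by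
    rw [hE]; exact ha.intervalIntegrable_energy (fun i => (he i).continuousOn) ht hs
  obtain ⟨H, hH⟩ : ∃ H, H = ∫ τ in t..(t + T), E τ := ⟨_, rfl⟩
  have hH0 : 0 ≤ H := by
    rw [hH]; exact intervalIntegral.integral_nonneg hle fun τ hτ => hE0 τ (ht.trans hτ.1)
  have hmove : ∀ s ∈ Set.Icc t (t + T), ∀ i, (e s i - e t i) ^ 2 ≤ c₁ * H + c₂ * η := by
    intro s hs i
    have hi : ∀ s, t ≤ s →
        IntervalIntegrable (fun τ => 2 * σ ^ 2 * (n * aM) * E τ + 2 * η) volume t s := fun s hs =>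
      ((hEi s hs).const_mul _).add (by simp)
    have h1 := (he i).sq_sub_le ht hs.1 (hi s hs.1) fun τ h1 h2 => by
      have hτ := ht.trans h1
      have h3 := laplacian_sq_le (ha.nonneg τ hτ) (ha.bounded τ hτ) (e τ) i
      have h4 := hd τ ⟨h1, h2.trans hs.2⟩ i
      have h5 := mul_le_mul_of_nonneg_left h3 (by positivity : 0 ≤ 2 * σ ^ 2)
      have h6 := sq_nonneg (-σ * (∑ j, a τ i j * (e τ i - e τ j)) - d τ i)
      rw [hE]
      nlinarith
    have h2 : ∫ τ in t..s, (2 * σ ^ 2 * (n * aM) * E τ + 2 * η) ≤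
        ∫ τ in t..(t + T), (2 * σ ^ 2 * (n * aM) * E τ + 2 * η) := by
      refine intervalIntegral.integral_mono_interval le_rfl hs.1 hs.2 ?_ (hi _ hle)
      refine (ae_restrict_iff' measurableSet_Ioc).2 (Filter.Eventually.of_forall fun r hr => ?_)
      have := hE0 r (ht.trans hr.1.le)
      simp only [Pi.zero_apply]
      positivity
    have h3 : ∫ τ in t..(t + T), (2 * σ ^ 2 * (n * aM) * E τ + 2 * η) =
        2 * σ ^ 2 * (n * aM) * H + 2 * η * T := by
      rw [intervalIntegral.integral_add ((hEi _ hle).const_mul _) (by simp),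
        intervalIntegral.integral_const_mul, intervalIntegral.integral_const, ← hH, smul_eq_mul]
      ring
    have h4 : 0 ≤ 2 * σ ^ 2 * (n * aM) * H + 2 * η * T := by positivity
    have hsT : s - t ≤ T := by linarith [hs.2]
    calc _ ≤ _ := h1
      _ ≤ (s - t) * (2 * σ ^ 2 * (n * aM) * H + 2 * η * T) :=
        mul_le_mul_of_nonneg_left (h2.trans_eq h3) (by linarith [hs.1])
      _ ≤ T * (2 * σ ^ 2 * (n * aM) * H + 2 * η * T) := mul_le_mul_of_nonneg_right hsT h4
      _ = _ := by rw [hc₁, hc₂]; ring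
  obtain ⟨V, hV⟩ : ∃ V, V = ∑ i, e t i ^ 2 := ⟨_, rfl⟩
  have hspread : V ≤ b₁ * H + b₂ * η := by
    have h1 := consensus_spread ha hδ hT ht (hconn t ht) (hEi _ hle)
      (by simp : IntervalIntegrable (fun _ => c₁ * H + c₂ * η) volume t (t + T))
      (fun τ hτ i j => by
        rw [hE]; exact edge_energy_le (ha.nonneg τ (ht.trans hτ.1)) (e τ) i j) hmove
    rw [intervalIntegral.integral_const, smul_eq_mul, add_sub_cancel_left, ← hH] at h1
    have h2 : ∀ i, e t i ^ 2 ≤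
        n ^ 2 * ((2 * H + 8 * aM * (T * (c₁ * H + c₂ * η))) / δ) := by
      intro i
      -- The mean-free hypothesis turns a bound on the differences into a bound on the entries.
      have h3 : n * e t i = ∑ j, (e t i - e t j) := by
        rw [Finset.sum_sub_distrib, h0 t ht]; simp
      have h4 : (n * e t i) ^ 2 ≤ n * ∑ j, (e t i - e t j) ^ 2 := by
        rw [h3]
        simpa using sq_sum_le_card_mul_sum_sq (s := Finset.univ) (f := fun j => e t i - e t j)
      have h5 := Finset.sum_le_sum fun j (_ : j ∈ Finset.univ) => h1 i j
      rw [Finset.sum_const, Finset.card_univ, Fintype.card_fin, nsmul_eq_mul] at h5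
      have h6 : (n : ℝ) ^ 2 * e t i ^ 2 ≤
          n ^ 2 * (n ^ 2 * ((2 * H + 8 * aM * (T * (c₁ * H + c₂ * η))) / δ)) := by
        calc _ = (n * e t i) ^ 2 := by ring
          _ ≤ _ := h4.trans (mul_le_mul_of_nonneg_left h5 hn.le)
          _ = _ := by ring
      exact le_of_mul_le_mul_left h6 (by positivity)
    have h3 := Finset.sum_le_sum fun i (_ : i ∈ Finset.univ) => h2 i
    rw [Finset.sum_const, Finset.card_univ, Fintype.card_fin, nsmul_eq_mul, ← hV] at h3
    have h4 : 0 ≤ (1 + σ) * H := by positivity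
    calc V ≤ _ := h3
      _ = (n ^ 3 * (2 + 8 * aM * T * c₁) / δ) * H + b₂ * η := by rw [hb₂]; ring
      _ ≤ _ := by rw [hb₁]; linarith
  have hVs : ∀ s ∈ Set.Icc t (t + T), ∑ i, e s i ^ 2 ≤ 2 * V + 2 * n * (c₁ * H + c₂ * η) := by
    intro s hs
    have h1 : ∀ i, e s i ^ 2 ≤ 2 * e t i ^ 2 + 2 * (c₁ * H + c₂ * η) := fun i => by
      nlinarith [hmove s hs i, sq_nonneg (e s i - 2 * e t i)]
    have h3 := Finset.sum_le_sum fun i (_ : i ∈ Finset.univ) => h1 i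
    rw [Finset.sum_add_distrib, Finset.sum_const, Finset.card_univ, Fintype.card_fin,
      nsmul_eq_mul, ← Finset.mul_sum, ← hV] at h3
    linarith
  have hrate := HasRate.sum Finset.univ fun i _ => (he i).mul (he i)
  have hint := hrate.sub_eq_integral ht (ht.trans hle)
  have hbound : ∫ τ in t..(t + T), ∑ i, ((-σ * (∑ j, a τ i j * (e τ i - e τ j)) + d τ i) * e τ i +
      e τ i * (-σ * (∑ j, a τ i j * (e τ i - e τ j)) + d τ i)) ≤
      ∫ τ in t..(t + T), (-σ * E τ + (ε * (2 * V + 2 * n * (c₁ * H + c₂ * η)) + n * η / ε)) := by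
    refine intervalIntegral.integral_mono_on hle (hrate.intervalIntegrable ht (ht.trans hle))
      (((hEi _ hle).const_mul _).add (by simp)) fun τ hτ => ?_
    have h1 : ∑ i, ((-σ * (∑ j, a τ i j * (e τ i - e τ j)) + d τ i) * e τ i +
        e τ i * (-σ * (∑ j, a τ i j * (e τ i - e τ j)) + d τ i)) =
        -(2 * σ) * (∑ i, e τ i * ∑ j, a τ i j * (e τ i - e τ j)) + ∑ i, 2 * (e τ i * d τ i) := by
      rw [Finset.mul_sum, ← Finset.sum_add_distrib]
      exact Finset.sum_congr rfl fun i _ => by ring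
    rw [h1, laplacian_energy (ha.symm τ (ht.trans hτ.1)) (e τ)]
    have h2 : ∑ i, 2 * (e τ i * d τ i) ≤ ∑ i, (ε * e τ i ^ 2 + η / ε) := by
      refine Finset.sum_le_sum fun i _ => ?_
      have h3 : 2 * (e τ i * d τ i) ≤ ε * e τ i ^ 2 + d τ i ^ 2 / ε := by
        have h4 : 0 ≤ (ε * e τ i - d τ i) ^ 2 / ε := by positivity
        have h5 : (ε * e τ i - d τ i) ^ 2 / ε =
            ε * e τ i ^ 2 - 2 * (e τ i * d τ i) + d τ i ^ 2 / ε := by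
          field_simp; ring
        linarith
      exact h3.trans (add_le_add le_rfl (div_le_div_of_nonneg_right (hd τ hτ i) hε0.le))
    rw [Finset.sum_add_distrib, Finset.sum_const, Finset.card_univ, Fintype.card_fin,
      nsmul_eq_mul, ← Finset.mul_sum Finset.univ (fun i => e τ i ^ 2)] at h2
    have h3 := mul_le_mul_of_nonneg_left (hVs τ hτ) hε0.le
    rw [hE, mul_div_assoc]
    beta_reduce
    linarith
  rw [← hint, intervalIntegral.integral_add ((hEi _ hle).const_mul _) (by simp),
    intervalIntegral.integral_const_mul, intervalIntegral.integral_const, ← hH, smul_eq_mul,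
    add_sub_cancel_left] at hbound
  simp only [← pow_two] at hbound
  rw [← hV] at hbound ⊢
  have hV0 : 0 ≤ V := by rw [hV]; positivity
  have hHV : σ / 2 * ((V - b₂ * η) / b₁) ≤ σ / 2 * H :=
    mul_le_mul_of_nonneg_left ((div_le_iff₀ hb₁0).2 (by linarith)) (by positivity)
  have e1 : σ / 2 * ((V - b₂ * η) / b₁) = 2 * (σ / (4 * b₁)) * V - σ * b₂ / (2 * b₁) * η := by
    field_simp; ring
  have h7 := mul_le_mul_of_nonneg_right hε₁ hH0
  have h8 := mul_le_mul_of_nonneg_right hε₂ hV0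
  have e2 : T * (ε * (2 * V + 2 * n * (c₁ * H + c₂ * η)) + n * η / ε) =
      2 * ε * T * V + 2 * n * T * ε * c₁ * H + (2 * n * T * ε * c₂ + n * T / ε) * η := by ring
  rw [e1] at hHV
  rw [e2] at hbound
  linarith

end Window

/-! ### Quadratic forms -/

section QuadraticForm

variable {κ : Type} [Fintype κ]

theorem dotProduct_self_nonneg_real (u : κ → ℝ) : 0 ≤ u ⬝ᵥ u :=
  Finset.sum_nonneg fun c _ => mul_self_nonneg (u c)

theorem sq_le_dotProduct_self (u : κ → ℝ) (c : κ) : u c ^ 2 ≤ u ⬝ᵥ u := by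
  rw [pow_two]
  exact Finset.single_le_sum (f := fun c => u c * u c) (fun c _ => mul_self_nonneg (u c))
    (Finset.mem_univ c)

theorem dotProduct_self_le_card {u : κ → ℝ} {r : ℝ} (h : ∀ c, u c ^ 2 ≤ r) :
    u ⬝ᵥ u ≤ Fintype.card κ * r := by
  have := Finset.sum_le_sum fun c (_ : c ∈ Finset.univ) => h c
  simpa [dotProduct, pow_two] using this

theorem dotProduct_self_add_le (u v : κ → ℝ) :
    (u + v) ⬝ᵥ (u + v) ≤ 2 * (u ⬝ᵥ u) + 2 * (v ⬝ᵥ v) := by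
  have h := dotProduct_self_nonneg_real (u - v)
  simp only [add_dotProduct, dotProduct_add, sub_dotProduct, dotProduct_sub] at h ⊢
  linarith

theorem form_add_le {N : Matrix κ κ ℝ} (hN : ∀ u : κ → ℝ, 0 ≤ u ⬝ᵥ N.mulVec u) (u v : κ → ℝ) :
    (u + v) ⬝ᵥ N.mulVec (u + v) ≤ 2 * (u ⬝ᵥ N.mulVec u) + 2 * (v ⬝ᵥ N.mulVec v) := by
  have h := hN (u - v)
  simp only [add_dotProduct, dotProduct_add, sub_dotProduct, dotProduct_sub, Matrix.mulVec_add,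
    Matrix.mulVec_sub] at h ⊢
  linarith

theorem mulVec_dotProduct_of_isSymm {R : Matrix κ κ ℝ} (hR : R.IsSymm) (u v : κ → ℝ) :
    R.mulVec u ⬝ᵥ v = u ⬝ᵥ R.mulVec v := by
  rw [dotProduct_comm, Matrix.dotProduct_mulVec, ← Matrix.mulVec_transpose, hR.eq,
    dotProduct_comm]

/-- Evaluate the form of R at K x - R x, where it is nonnegative, and at R x, where it is at most K
|R x|². This replaces R² ≤ K R without spectral theory. -/
theorem mulVec_sq_le_form {R : Matrix κ κ ℝ} {K : ℝ} (hK : 0 < K) (hR : R.IsSymm)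
    (h0 : ∀ u : κ → ℝ, 0 ≤ u ⬝ᵥ R.mulVec u)
    (h1 : ∀ u : κ → ℝ, u ⬝ᵥ R.mulVec u ≤ K * (u ⬝ᵥ u)) (x : κ → ℝ) :
    R.mulVec x ⬝ᵥ R.mulVec x ≤ K * (x ⬝ᵥ R.mulVec x) := by
  have h := h0 (K • x - R.mulVec x)
  have h2 := h1 (R.mulVec x)
  simp only [sub_dotProduct, dotProduct_sub, Matrix.mulVec_sub, Matrix.mulVec_smul,
    smul_dotProduct, dotProduct_smul, smul_eq_mul] at h
  rw [← mulVec_dotProduct_of_isSymm hR x (R.mulVec x)] at h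
  refine le_of_mul_le_mul_left ?_ hK
  linarith

/-- The resolvent `(1 + P)⁻¹` of a positive semidefinite matrix is a contraction, and it displaces
`x` by at most the energy of `x`, uniformly in the size of `P`. -/
theorem exists_resolvent [DecidableEq κ] {P : Matrix κ κ ℝ} (hP : P.IsSymm)
    (h0 : ∀ u : κ → ℝ, 0 ≤ u ⬝ᵥ P.mulVec u) :
    ∃ G : Matrix κ κ ℝ, (∀ x, G.mulVec (P.mulVec x) = x - G.mulVec x) ∧
      (∀ u, G.mulVec u ⬝ᵥ G.mulVec u ≤ u ⬝ᵥ u) ∧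
      ∀ x, (x - G.mulVec x) ⬝ᵥ (x - G.mulVec x) ≤ x ⬝ᵥ P.mulVec x := by
  have hinj : Function.Injective (1 + P).mulVec := by
    refine (injective_iff_map_eq_zero (1 + P).mulVecLin).2 fun u hu => ?_
    rw [Matrix.mulVecLin_apply, Matrix.add_mulVec, Matrix.one_mulVec] at hu
    have h1 : u ⬝ᵥ (u + P.mulVec u) = 0 := by rw [hu, dotProduct_zero]
    rw [dotProduct_add] at h1
    exact dotProduct_self_eq_zero.1 (le_antisymm (by linarith [h0 u])
      (dotProduct_self_nonneg_real u))
  have hunit : IsUnit (1 + P) := Matrix.mulVec_injective_iff_isUnit.1 hinj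
  have hdet : IsUnit (1 + P).det := (Matrix.isUnit_iff_isUnit_det _).1 hunit
  have hl : ∀ x : κ → ℝ, ((1 + P)⁻¹).mulVec (x + P.mulVec x) = x := fun x => by
    have : x + P.mulVec x = (1 + P).mulVec x := by rw [Matrix.add_mulVec, Matrix.one_mulVec]
    rw [this, Matrix.mulVec_mulVec, Matrix.nonsing_inv_mul _ hdet, Matrix.one_mulVec]
  have hr : ∀ x : κ → ℝ, ((1 + P)⁻¹).mulVec x + P.mulVec (((1 + P)⁻¹).mulVec x) = x :=
    fun x => by
      have := Matrix.mulVec_mulVec x (1 + P) (1 + P)⁻¹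
      rw [Matrix.mul_nonsing_inv _ hdet, Matrix.one_mulVec, Matrix.add_mulVec,
        Matrix.one_mulVec] at this
      exact this
  refine ⟨(1 + P)⁻¹, fun x => ?_, fun u => ?_, fun x => ?_⟩
  · have := hl x
    rw [Matrix.mulVec_add] at this
    exact eq_sub_of_add_eq' this
  -- With u = y + P y one has |u|² = |y|² + 2 y ⬝ P y + |P y|².
  · obtain ⟨y, hy⟩ : ∃ y, y = ((1 + P)⁻¹).mulVec u := ⟨_, rfl⟩
    have hu := hr u
    rw [← hy] at hu ⊢
    rw [← hu]
    have h1 := h0 y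
    have h2 := dotProduct_self_nonneg_real (P.mulVec y)
    simp only [add_dotProduct, dotProduct_add]
    rw [dotProduct_comm (P.mulVec y) y]
    linarith
  -- Here x - y = P y, while x ⬝ P x = y ⬝ P y + 2 |P y|² + P y ⬝ P (P y).
  · obtain ⟨y, hy⟩ : ∃ y, y = ((1 + P)⁻¹).mulVec x := ⟨_, rfl⟩
    have hu := hr x
    rw [← hy] at hu ⊢
    rw [← hu, add_sub_cancel_left]
    have h1 := h0 y
    have h2 := h0 (P.mulVec y)
    have h3 := dotProduct_self_nonneg_real (P.mulVec y)
    simp only [add_dotProduct, dotProduct_add, Matrix.mulVec_add]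
    rw [← mulVec_dotProduct_of_isSymm hP y (P.mulVec y)]
    linarith

end QuadraticForm

/-! ### Consensus with a positive semidefinite leak -/

section Leak

variable {n : ℕ} {a : ℝ → Matrix (Fin n) (Fin n) ℝ} {aM δ T : ℝ} {κ : Type} [Fintype κ]

/-- The energy `∑ i, x_i ⬝ M_i x_i + (1/2) ∑ i j, a_ij |x_i - x_j|²` dissipated by leaky
consensus. -/
noncomputable def dissipation (A : Matrix (Fin n) (Fin n) ℝ) (M : Fin n → Matrix κ κ ℝ)
    (x : Fin n → κ → ℝ) : ℝ :=
  ∑ i, x i ⬝ᵥ (M i).mulVec (x i) + 1 / 2 * ∑ c, ∑ i, ∑ j, A i j * (x i c - x j c) ^ 2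

theorem dissipation_nonneg {A : Matrix (Fin n) (Fin n) ℝ} {M : Fin n → Matrix κ κ ℝ}
    (hA : ∀ i j, 0 ≤ A i j) (hM : ∀ i (u : κ → ℝ), 0 ≤ u ⬝ᵥ (M i).mulVec u)
    (x : Fin n → κ → ℝ) : 0 ≤ dissipation A M x :=
  add_nonneg (Finset.sum_nonneg fun i _ => hM i (x i)) (mul_nonneg (by norm_num)
    (Finset.sum_nonneg fun c _ => Finset.sum_nonneg fun i _ => Finset.sum_nonneg fun j _ =>
      mul_nonneg (hA i j) (sq_nonneg _)))

theorem form_le_dissipation {A : Matrix (Fin n) (Fin n) ℝ} {M : Fin n → Matrix κ κ ℝ}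
    (hA : ∀ i j, 0 ≤ A i j) (hM : ∀ i (u : κ → ℝ), 0 ≤ u ⬝ᵥ (M i).mulVec u)
    (x : Fin n → κ → ℝ) (i : Fin n) : x i ⬝ᵥ (M i).mulVec (x i) ≤ dissipation A M x :=
  (Finset.single_le_sum (f := fun i => x i ⬝ᵥ (M i).mulVec (x i)) (fun i _ => hM i (x i))
    (Finset.mem_univ i)).trans (le_add_of_nonneg_right (mul_nonneg (by norm_num)
    (Finset.sum_nonneg fun c _ => Finset.sum_nonneg fun i _ => Finset.sum_nonneg fun j _ =>
      mul_nonneg (hA i j) (sq_nonneg _))))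

theorem disagreement_le_dissipation {A : Matrix (Fin n) (Fin n) ℝ} {M : Fin n → Matrix κ κ ℝ}
    (hM : ∀ i (u : κ → ℝ), 0 ≤ u ⬝ᵥ (M i).mulVec u) (x : Fin n → κ → ℝ) :
    ∑ c, ∑ i, ∑ j, A i j * (x i c - x j c) ^ 2 ≤ 2 * dissipation A M x := by
  have := Finset.sum_nonneg fun i (_ : i ∈ Finset.univ) => hM i (x i)
  rw [dissipation]
  linarith

variable {x : ℝ → Fin n → κ → ℝ} {M : ℝ → Fin n → Matrix κ κ ℝ}

theorem leaky_energy_rate (ha : IsUndirectedNetwork a aM)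
    (hx : ∀ i c, HasRate (fun τ => x τ i c)
      fun τ => -((M τ i).mulVec (x τ i) c) - ∑ j, a τ i j * (x τ i c - x τ j c)) :
    HasRate (fun τ => ∑ i, x τ i ⬝ᵥ x τ i) fun τ => -2 * dissipation (a τ) (M τ) (x τ) := by
  have h := HasRate.sum Finset.univ fun i _ => HasRate.sum Finset.univ fun c _ =>
    (hx i c).mul (hx i c)
  refine h.congr fun τ hτ => ?_
  have h1 : ∀ c, ∑ i, x τ i c * ∑ j, a τ i j * (x τ i c - x τ j c) =
      1 / 2 * ∑ i, ∑ j, a τ i j * (x τ i c - x τ j c) ^ 2 := fun c =>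
    laplacian_energy (ha.symm τ hτ) fun i => x τ i c
  rw [dissipation, Finset.mul_sum (a := (1 : ℝ) / 2), ← Finset.sum_congr rfl fun c _ => h1 c,
    Finset.sum_comm (s := (Finset.univ : Finset κ)), ← Finset.sum_add_distrib, Finset.mul_sum]
  refine Finset.sum_congr rfl fun i _ => ?_
  rw [dotProduct, ← Finset.sum_add_distrib, Finset.mul_sum]
  exact Finset.sum_congr rfl fun c _ => by ring

/-- P is the leak frozen at the start of the window and may be arbitrarily large; K bounds only the
lower bound N of P and the remainder M - P, so C is uniform in P. A small energy loss makes each x i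
close to a constant y i, the y i close to one another, and each N i small on y i. Since the forms of
the N i add up to at least γ, all y i are small, and so is the energy. -/
theorem exists_leaky_consensus_contraction [DecidableEq κ] (ha : IsUndirectedNetwork a aM)
    (hδ : 0 < δ) (hT : 0 < T) (hconn : IsJointlyConnected a δ T) {K γ : ℝ} (hK : 0 < K)
    (hγ : 0 < γ) :
    ∃ C : ℝ, 0 ≤ C ∧ ∀ (x : ℝ → Fin n → κ → ℝ) (M : ℝ → Fin n → Matrix κ κ ℝ)
      (P N : Fin n → Matrix κ κ ℝ) (t : ℝ), 0 ≤ t →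
      (∀ i c, HasRate (fun τ => x τ i c)
        fun τ => -((M τ i).mulVec (x τ i) c) - ∑ j, a τ i j * (x τ i c - x τ j c)) →
      (∀ i, (P i).IsSymm) →
      (∀ i (u : κ → ℝ), 0 ≤ u ⬝ᵥ (N i).mulVec u) →
      (∀ i (u : κ → ℝ), u ⬝ᵥ (N i).mulVec u ≤ K * (u ⬝ᵥ u)) →
      (∀ i (u : κ → ℝ), u ⬝ᵥ (N i).mulVec u ≤ u ⬝ᵥ (P i).mulVec u) →
      (∀ u : κ → ℝ, γ * (u ⬝ᵥ u) ≤ ∑ i, u ⬝ᵥ (N i).mulVec u) →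
      (∀ τ ∈ Set.Icc t (t + T), ∀ i, (M τ i - P i).IsSymm) →
      (∀ τ ∈ Set.Icc t (t + T), ∀ i (u : κ → ℝ), 0 ≤ u ⬝ᵥ (M τ i - P i).mulVec u) →
      (∀ τ ∈ Set.Icc t (t + T), ∀ i (u : κ → ℝ),
        u ⬝ᵥ (M τ i - P i).mulVec u ≤ K * (u ⬝ᵥ u)) →
      ∑ i, x (t + T) i ⬝ᵥ x (t + T) i ≤
        C * (∑ i, x t i ⬝ᵥ x t i - ∑ i, x (t + T) i ⬝ᵥ x (t + T) i) := by
  obtain ⟨i₀⟩ := (hconn 0 le_rfl).nonempty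
  have haM : 0 ≤ aM := (ha.nonneg 0 le_rfl i₀ i₀).trans (ha.bounded 0 le_rfl i₀ i₀)
  obtain ⟨p, hp⟩ : ∃ p : ℝ, p = Fintype.card κ := ⟨_, rfl⟩
  have hp0 : 0 ≤ p := by rw [hp]; positivity
  -- All constants multiply the window dissipation H: c₁ for the displacement after the resolvent,
  -- c₂ for the spread of y, c₃ and c₄ for its leak, c₅ for the final energy. The energy loss is 2
  -- H, whence C = c₅ / 2.
  obtain ⟨c₁, hc₁⟩ : ∃ c, c = 3 * T * (1 + K + 2 * p * n * aM) := ⟨_, rfl⟩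
  obtain ⟨c₂, hc₂⟩ : ∃ c, c = n ^ 2 * ((4 + 8 * aM * (2 + 2 * T * c₁)) / δ) := ⟨_, rfl⟩
  obtain ⟨c₃, hc₃⟩ : ∃ c, c = 2 + 2 * K * p * (2 + 2 * T * c₁) := ⟨_, rfl⟩
  obtain ⟨c₄, hc₄⟩ : ∃ c, c = n * (2 * (c₃ / T) + 2 * K * p * c₂) := ⟨_, rfl⟩
  obtain ⟨c₅, hc₅⟩ : ∃ c, c = 2 * n * (c₄ / γ) + 2 * n * p * (2 + 2 * T * c₁) / T := ⟨_, rfl⟩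
  have hc₁0 : 0 ≤ c₁ := by rw [hc₁]; positivity
  have hc₂0 : 0 ≤ c₂ := by rw [hc₂]; positivity
  have hc₃0 : 0 ≤ c₃ := by rw [hc₃]; positivity
  have hc₄0 : 0 ≤ c₄ := by rw [hc₄]; positivity
  have hc₅0 : 0 ≤ c₅ := by rw [hc₅]; positivity
  refine ⟨c₅ / 2, by positivity, fun x M P N t ht hx hPs hN0 hNK hNP hNγ hRs hR0 hRK => ?_⟩
  have hle : t ≤ t + T := by linarith
  have hP0 : ∀ i (u : κ → ℝ), 0 ≤ u ⬝ᵥ (P i).mulVec u := fun i u => (hN0 i u).trans (hNP i u)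
  have hMsplit : ∀ τ i (u : κ → ℝ), (M τ i).mulVec u =
      (P i).mulVec u + (M τ i - P i).mulVec u := fun τ i u => by
    rw [← Matrix.add_mulVec, add_sub_cancel]
  have hPM : ∀ τ ∈ Set.Icc t (t + T), ∀ i (u : κ → ℝ),
      u ⬝ᵥ (P i).mulVec u ≤ u ⬝ᵥ (M τ i).mulVec u := fun τ hτ i u => by
    rw [hMsplit, dotProduct_add]; linarith [hR0 τ hτ i u]
  have hRM : ∀ τ ∈ Set.Icc t (t + T), ∀ i (u : κ → ℝ),
      u ⬝ᵥ (M τ i - P i).mulVec u ≤ u ⬝ᵥ (M τ i).mulVec u := fun τ hτ i u => by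
    rw [hMsplit τ i u, dotProduct_add]; linarith [hP0 i u]
  have hM0 : ∀ τ ∈ Set.Icc t (t + T), ∀ i (u : κ → ℝ), 0 ≤ u ⬝ᵥ (M τ i).mulVec u :=
    fun τ hτ i u => (hP0 i u).trans (hPM τ hτ i u)
  have hA0 : ∀ τ ∈ Set.Icc t (t + T), ∀ i j, 0 ≤ a τ i j := fun τ hτ =>
    ha.nonneg τ (ht.trans hτ.1)
  have hV := leaky_energy_rate ha hx
  obtain ⟨h, hh⟩ : ∃ h : ℝ → ℝ, h = fun τ => dissipation (a τ) (M τ) (x τ) := ⟨_, rfl⟩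
  have hh' : ∀ τ, h τ = dissipation (a τ) (M τ) (x τ) := fun τ => by rw [hh]
  simp only [← hh'] at hV
  have hhi : ∀ s, t ≤ s → IntervalIntegrable h volume t s := fun s hs => by
    have := (hV.intervalIntegrable ht (ht.trans hs)).const_mul (-1 / 2)
    refine this.congr fun τ _ => ?_
    ring
  have hh0 : ∀ τ ∈ Set.Icc t (t + T), 0 ≤ h τ := fun τ hτ => by
    rw [hh']; exact dissipation_nonneg (hA0 τ hτ) (hM0 τ hτ) _
  have hform : ∀ τ ∈ Set.Icc t (t + T), ∀ i, x τ i ⬝ᵥ (M τ i).mulVec (x τ i) ≤ h τ :=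
    fun τ hτ i => by rw [hh']; exact form_le_dissipation (hA0 τ hτ) (hM0 τ hτ) _ i
  have hdis : ∀ τ ∈ Set.Icc t (t + T), ∀ c,
      ∑ i, ∑ j, a τ i j * (x τ i c - x τ j c) ^ 2 ≤ 2 * h τ := fun τ hτ c => by
    rw [hh']
    exact (Finset.single_le_sum (f := fun c => ∑ i, ∑ j, a τ i j * (x τ i c - x τ j c) ^ 2)
      (fun c _ => Finset.sum_nonneg fun i _ => Finset.sum_nonneg fun j _ =>
        mul_nonneg (hA0 τ hτ i j) (sq_nonneg _)) (Finset.mem_univ c)).trans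
      (disagreement_le_dissipation (hM0 τ hτ) _)
  obtain ⟨H, hH⟩ : ∃ H, H = ∫ τ in t..(t + T), h τ := ⟨_, rfl⟩
  have hH0 : 0 ≤ H := by rw [hH]; exact intervalIntegral.integral_nonneg hle hh0
  choose G hGP hG1 hG2 using fun i => exists_resolvent (hPs i) (hP0 i)
  obtain ⟨y, hy⟩ : ∃ y : Fin n → κ → ℝ, y = fun i => (G i).mulVec (x t i) := ⟨_, rfl⟩
  have hmove : ∀ s ∈ Set.Icc t (t + T), ∀ i c,
      ((G i).mulVec (x s i) c - y i c) ^ 2 ≤ c₁ * H := by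
    intro s hs i c
    obtain ⟨ℓ, hℓ⟩ : ∃ ℓ : ℝ → κ → ℝ, ℓ = fun τ d => ∑ j, a τ i j * (x τ i d - x τ j d) :=
      ⟨_, rfl⟩
    have hr : HasRate (fun τ => (G i).mulVec (x τ i) c) fun τ =>
        (G i).mulVec (-(M τ i).mulVec (x τ i) - ℓ τ) c := by
      refine (HasRate.sum Finset.univ fun d _ => (hx i d).const_mul (G i c d)).congr
        fun τ _ => ?_
      simp only [Matrix.mulVec, dotProduct, hℓ, Pi.sub_apply, Pi.neg_apply]
    have h1 := hr.sq_sub_le ht hs.1 ((hhi s hs.1).const_mul (3 * (1 + K + 2 * p * n * aM)))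
      fun τ h1 h2 => by
        have hτ : τ ∈ Set.Icc t (t + T) := ⟨h1, h2.trans hs.2⟩
        refine (sq_le_dotProduct_self _ c).trans ?_
        obtain ⟨u, hu⟩ : ∃ u, u = x τ i - (G i).mulVec (x τ i) := ⟨_, rfl⟩
        obtain ⟨v, hv⟩ : ∃ v, v = (M τ i - P i).mulVec (x τ i) := ⟨_, rfl⟩
        -- The unbounded part of the rate becomes G P x = x - G x, whose square is at most the
        -- dissipation. The factor 3 in c₁ comes from squaring a sum of three terms.
        have e : (G i).mulVec (-(M τ i).mulVec (x τ i) - ℓ τ) =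
            -(u + ((G i).mulVec v + (G i).mulVec (ℓ τ))) := by
          rw [hMsplit, hu, ← hGP, ← hv, Matrix.mulVec_sub, Matrix.mulVec_neg, Matrix.mulVec_add]
          abel
        have b1 : u ⬝ᵥ u ≤ h τ := by
          rw [hu]; exact (hG2 i _).trans ((hPM τ hτ i _).trans (hform τ hτ i))
        have b2 : (G i).mulVec v ⬝ᵥ (G i).mulVec v ≤ K * h τ := by
          refine (hG1 i v).trans ?_
          rw [hv]
          exact (mulVec_sq_le_form hK (hRs τ hτ i) (hR0 τ hτ i) (hRK τ hτ i) _).trans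
            (mul_le_mul_of_nonneg_left ((hRM τ hτ i _).trans (hform τ hτ i)) hK.le)
        have b3 : (G i).mulVec (ℓ τ) ⬝ᵥ (G i).mulVec (ℓ τ) ≤ 2 * p * n * aM * h τ := by
          refine (hG1 i _).trans ?_
          have : ∀ d, ℓ τ d ^ 2 ≤ n * aM * (2 * h τ) := fun d => by
            rw [hℓ]
            exact (laplacian_sq_le (hA0 τ hτ) (ha.bounded τ (ht.trans hτ.1))
              (fun i => x τ i d) i).trans (mul_le_mul_of_nonneg_left (hdis τ hτ d)
                (by positivity))
          refine (dotProduct_self_le_card this).trans_eq ?_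
          rw [← hp]; ring
        rw [e, neg_dotProduct, dotProduct_neg, neg_neg]
        obtain ⟨w, hw⟩ : ∃ w, w = (G i).mulVec v := ⟨_, rfl⟩
        obtain ⟨z, hz⟩ : ∃ z, z = (G i).mulVec (ℓ τ) := ⟨_, rfl⟩
        rw [← hw] at b2 ⊢
        rw [← hz] at b3 ⊢
        have n1 := dotProduct_self_nonneg_real (u - w)
        have n2 := dotProduct_self_nonneg_real (u - z)
        have n3 := dotProduct_self_nonneg_real (w - z)
        simp only [add_dotProduct, dotProduct_add, sub_dotProduct, dotProduct_sub] at n1 n2 n3 ⊢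
        linarith
    have h2 : ∫ τ in t..s, 3 * (1 + K + 2 * p * n * aM) * h τ ≤
        ∫ τ in t..(t + T), 3 * (1 + K + 2 * p * n * aM) * h τ := by
      refine intervalIntegral.integral_mono_interval le_rfl hs.1 hs.2 ?_ ((hhi _ hle).const_mul _)
      refine (ae_restrict_iff' measurableSet_Ioc).2 (Filter.Eventually.of_forall fun r hr => ?_)
      exact mul_nonneg (by positivity) (hh0 r ⟨hr.1.le, hr.2⟩)
    rw [intervalIntegral.integral_const_mul (a := t) (b := t + T), ← hH] at h2
    have h4 : 0 ≤ 3 * (1 + K + 2 * p * n * aM) * H := by positivity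
    rw [hy]
    calc _ ≤ _ := h1
      _ ≤ (s - t) * (3 * (1 + K + 2 * p * n * aM) * H) :=
        mul_le_mul_of_nonneg_left h2 (by linarith [hs.1])
      _ ≤ T * (3 * (1 + K + 2 * p * n * aM) * H) :=
        mul_le_mul_of_nonneg_right (by linarith [hs.2]) h4
      _ = _ := by rw [hc₁]; ring
  obtain ⟨e, he⟩ : ∃ e : ℝ → ℝ, e = fun τ => 2 * h τ + 2 * (c₁ * H) := ⟨_, rfl⟩
  have hei : IntervalIntegrable e volume t (t + T) := by
    rw [he]; exact ((hhi _ hle).const_mul 2).add (by simp)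
  have heH : ∫ τ in t..(t + T), e τ = (2 + 2 * T * c₁) * H := by
    rw [he, intervalIntegral.integral_add ((hhi _ hle).const_mul 2) (by simp),
      intervalIntegral.integral_const_mul, intervalIntegral.integral_const, ← hH, smul_eq_mul]
    ring
  have hxy : ∀ τ ∈ Set.Icc t (t + T), ∀ i c, (x τ i c - y i c) ^ 2 ≤ e τ := by
    intro τ hτ i c
    have h1 := hmove τ hτ i c
    have h2 := (sq_le_dotProduct_self _ c).trans
      ((hG2 i (x τ i)).trans ((hPM τ hτ i _).trans (hform τ hτ i)))
    rw [Pi.sub_apply] at h2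
    rw [he]
    nlinarith [sq_nonneg ((x τ i c - (G i).mulVec (x τ i) c) -
      ((G i).mulVec (x τ i) c - y i c))]
  have hxy' : ∀ τ ∈ Set.Icc t (t + T), ∀ i, (y i - x τ i) ⬝ᵥ (y i - x τ i) ≤ p * e τ :=
    fun τ hτ i => by
      rw [hp]
      refine dotProduct_self_le_card fun c => ?_
      rw [Pi.sub_apply, ← neg_sub, neg_sq]
      exact hxy τ hτ i c
  have hspread : ∀ i j, (y i - y j) ⬝ᵥ (y i - y j) ≤ p * (c₂ * H) := by
    intro i j
    rw [hp]
    refine dotProduct_self_le_card fun c => ?_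
    have h1 := consensus_spread ha hδ hT ht (hconn t ht) (x := fun τ i => x τ i c)
      (y := fun i => y i c) ((hhi _ hle).const_mul 2) hei
      (fun τ hτ i j => (edge_energy_le (hA0 τ hτ) (fun i => x τ i c) i j).trans (hdis τ hτ c))
      (fun τ hτ i => hxy τ hτ i c) i j
    rw [intervalIntegral.integral_const_mul, ← hH, heH] at h1
    refine h1.trans_eq ?_
    rw [hc₂]; ring
  have hleak : ∀ i, y i ⬝ᵥ (N i).mulVec (y i) ≤ c₃ / T * H := by
    intro i
    have h1 : ∫ _ in t..(t + T), y i ⬝ᵥ (N i).mulVec (y i) ≤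
        ∫ τ in t..(t + T), (2 * h τ + 2 * K * p * e τ) := by
      refine intervalIntegral.integral_mono_on hle (by simp)
        (((hhi _ hle).const_mul 2).add (hei.const_mul _)) fun τ hτ => ?_
      have h2 := form_add_le (hN0 i) (x τ i) (y i - x τ i)
      rw [add_sub_cancel] at h2
      have h3 := (hNP i (x τ i)).trans ((hPM τ hτ i _).trans (hform τ hτ i))
      have h4 := (hNK i (y i - x τ i)).trans (mul_le_mul_of_nonneg_left (hxy' τ hτ i) hK.le)
      linarith
    rw [intervalIntegral.integral_const, intervalIntegral.integral_add ((hhi _ hle).const_mul 2)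
      (hei.const_mul _), intervalIntegral.integral_const_mul, intervalIntegral.integral_const_mul,
      ← hH, heH, smul_eq_mul, add_sub_cancel_left] at h1
    rw [div_mul_eq_mul_div, le_div_iff₀ hT, hc₃]
    linarith
  -- Only the sum of the N i is definite, so one vector y j must be tested against every N i; the
  -- small spread allows replacing y i by y j.
  have hyb : ∀ j, y j ⬝ᵥ y j ≤ c₄ / γ * H := by
    intro j
    have h1 : ∀ i, y j ⬝ᵥ (N i).mulVec (y j) ≤ 2 * (c₃ / T * H) + 2 * (K * (p * (c₂ * H))) := by
      intro i
      have h2 := form_add_le (hN0 i) (y i) (y j - y i)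
      rw [add_sub_cancel] at h2
      have h4 := (hNK i (y j - y i)).trans (mul_le_mul_of_nonneg_left (hspread j i) hK.le)
      linarith [hleak i]
    have h3 := (hNγ (y j)).trans (Finset.sum_le_sum fun i _ => h1 i)
    rw [Finset.sum_const, Finset.card_univ, Fintype.card_fin, nsmul_eq_mul] at h3
    rw [div_mul_eq_mul_div, le_div_iff₀ hγ, hc₄]
    linarith
  have hend : ∑ i, x (t + T) i ⬝ᵥ x (t + T) i ≤ c₅ * H := by
    -- The energy does not increase, so its final value is at most its average over the window,
    -- where x is close to y in the mean.
    have h1 : ∫ _ in t..(t + T), ∑ i, x (t + T) i ⬝ᵥ x (t + T) i ≤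
        ∫ τ in t..(t + T), (2 * n * (c₄ / γ * H) + 2 * n * p * e τ) := by
      refine intervalIntegral.integral_mono_on hle (by simp)
        ((by simp : IntervalIntegrable (fun _ => 2 * n * (c₄ / γ * H)) volume t (t + T)).add
          (hei.const_mul _)) fun τ hτ => ?_
      have h2 := hV.le_of_rate_nonpos (ht.trans hτ.1) hτ.2 fun s hs1 hs2 => by
        linarith [hh0 s ⟨hτ.1.trans hs1, hs2⟩]
      have h3 : ∀ i, x τ i ⬝ᵥ x τ i ≤ 2 * (c₄ / γ * H) + 2 * (p * e τ) := fun i => by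
        have h4 := dotProduct_self_add_le (y i) (x τ i - y i)
        have h5 := hxy' τ hτ i
        rw [← neg_sub, neg_dotProduct, dotProduct_neg, neg_neg] at h5
        rw [add_sub_cancel] at h4
        linarith [hyb i]
      have h4 := h2.trans (Finset.sum_le_sum fun i _ => h3 i)
      rw [Finset.sum_const, Finset.card_univ, Fintype.card_fin, nsmul_eq_mul] at h4
      linarith
    rw [intervalIntegral.integral_const, intervalIntegral.integral_add (by simp)
      (hei.const_mul _), intervalIntegral.integral_const, intervalIntegral.integral_const_mul,
      heH, smul_eq_mul, smul_eq_mul, add_sub_cancel_left] at h1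
    refine le_of_mul_le_mul_left (h1.trans_eq ?_) hT
    rw [hc₅]; field_simp
  have hdrop := hV.sub_eq_integral ht (ht.trans hle)
  rw [intervalIntegral.integral_const_mul, ← hH] at hdrop
  calc _ ≤ _ := hend
    _ = _ := by rw [← neg_sub, hdrop]; ring

end Leak

/-! ### The closed loop in error coordinates -/

section ErrorDynamics

variable {n m : ℕ}

/-- The gain matrix `μ_F Y_Fᵀ Y_F + μ_IF Y_IF` of agent `i` in the error dynamics. -/
noncomputable def dampingMat (g : Gains) (muIF : ℝ) (x : NetState n m) (i : Fin n) :
    Matrix (ParamIdx n m) (ParamIdx n m) ℝ :=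
  g.muF • ((x.YF i).transpose * x.YF i) + muIF • x.YIF i

/-- The bias block of the regressor is the negative of that of `Zmat`, and the first two entries of
the true parameter are 1. -/
theorem regressor_mulVec (A : Matrix (Fin n) (Fin n) ℝ) (k : ℝ) (acc : Fin m → ℝ)
    (b : Fin n → Fin m → ℝ) (x : NetState n m) (i : Fin n) :
    (regressor A k acc x i).mulVec (trueParam b) =
      acc + k • x.v i - (Zmat A k i).mulVec (trueParam b) := by
  funext r
  simp only [Matrix.mulVec, dotProduct, regressor, Zmat, trueParam, Matrix.of_apply,
    Fintype.sum_sum_type, Fin.sum_univ_two, Sum.elim_inl, Sum.elim_inr, Pi.add_apply,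
    Pi.sub_apply, Pi.smul_apply, smul_eq_mul, Matrix.cons_val_zero, Matrix.cons_val_one, mul_one]
  have : ∑ p : Fin n × Fin m, (if r = p.2 then 1 / 2 * k * signlessMat A i p.1 else 0) * b p.1 p.2
      = -∑ p : Fin n × Fin m,
        (if r = p.2 then -(1 / 2) * k * signlessMat A i p.1 else 0) * b p.1 p.2 := by
    rw [← Finset.sum_neg_distrib]
    refine Finset.sum_congr rfl fun p _ => ?_
    split_ifs <;> ring
  rw [this]
  ring

/-- The true parameter satisfies the linear regression `Y_i θ = w_i`. -/
theorem regressor_mulVec_trueParam (g : Gains) (muIF : ℝ) (A : Matrix (Fin n) (Fin n) ℝ) (k : ℝ)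
    (b : Fin n → Fin m → ℝ) (x : NetState n m) (i : Fin n) :
    (regressor A k (controlLaw g muIF A k b x i) x i).mulVec (trueParam b) =
      auxControl g muIF A k b x i := by
  rw [regressor_mulVec, controlLaw, auxControl, paramErr, Matrix.mulVec_sub]
  module

theorem adaptRate_eq (g : Gains) (muIF : ℝ) (A : Matrix (Fin n) (Fin n) ℝ)
    (b : Fin n → Fin m → ℝ) (x : NetState n m) (i : Fin n)
    (hw : x.wF i = (x.YF i).mulVec (trueParam b))
    (hw' : x.wIF i = (x.YIF i).mulVec (trueParam b)) (c : ParamIdx n m) :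
    adaptRate g muIF A x i c = (dampingMat g muIF x i).mulVec (paramErr b x i) c +
      ∑ j, A i j * (paramErr b x i c - paramErr b x j c) := by
  have h1 : ∑ j, A i j • (x.θhat i - x.θhat j) =
      -∑ j, A i j • (paramErr b x i - paramErr b x j) := by
    rw [← Finset.sum_neg_distrib]
    refine Finset.sum_congr rfl fun j _ => ?_
    rw [paramErr, paramErr]
    module
  rw [adaptRate, h1, hw, hw', ← Matrix.mulVec_sub, ← Matrix.mulVec_sub, dampingMat,
    Matrix.add_mulVec, Matrix.smul_mulVec, Matrix.smul_mulVec, ← Matrix.mulVec_mulVec,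
    sub_neg_eq_add]
  simp only [Pi.add_apply, Finset.sum_apply, Pi.smul_apply, Pi.sub_apply, smul_eq_mul, paramErr]

theorem sum_laplacianMat_smul (A : Matrix (Fin n) (Fin n) ℝ) (s : Fin n → Fin m → ℝ) (i : Fin n)
    (c : Fin m) : (∑ j, laplacianMat A i j • s j) c = ∑ j, A i j * (s i c - s j c) := by
  simp only [Finset.sum_apply, Pi.smul_apply, smul_eq_mul, laplacianMat, degreeMat,
    Matrix.sub_apply, Matrix.diagonal_apply, sub_mul, ite_mul, zero_mul, mul_sub,
    Finset.sum_sub_distrib, Finset.sum_ite_eq, Finset.mem_univ, if_true, Finset.sum_mul]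

theorem gram_form (Y : Matrix (Fin m) (ParamIdx n m) ℝ) (u : ParamIdx n m → ℝ) :
    u ⬝ᵥ (Y.transpose * Y).mulVec u = Y.mulVec u ⬝ᵥ Y.mulVec u := by
  rw [← Matrix.mulVec_mulVec, Matrix.dotProduct_mulVec, Matrix.vecMul_transpose]

theorem gram_form_le {Y : Matrix (Fin m) (ParamIdx n m) ℝ} {B : ℝ} (hB : ∀ r c, |Y r c| ≤ B)
    (u : ParamIdx n m → ℝ) : u ⬝ᵥ (Y.transpose * Y).mulVec u ≤
      m * (Fintype.card (ParamIdx n m) * B ^ 2) * (u ⬝ᵥ u) := by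
  rw [gram_form]
  have h : ∀ r, Y.mulVec u r ^ 2 ≤ Fintype.card (ParamIdx n m) * B ^ 2 * (u ⬝ᵥ u) := fun r => by
    have h1 : Y.mulVec u r ^ 2 ≤ (∑ c, Y r c ^ 2) * ∑ c, u c ^ 2 :=
      Finset.sum_mul_sq_le_sq_mul_sq _ _ _
    have h2 : ∑ c, Y r c ^ 2 ≤ Fintype.card (ParamIdx n m) * B ^ 2 := by
      have := Finset.sum_le_sum fun c (_ : c ∈ Finset.univ) =>
        (sq_le_sq' (abs_le.1 (hB r c)).1 (abs_le.1 (hB r c)).2)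
      rwa [Finset.sum_const, Finset.card_univ, nsmul_eq_mul] at this
    have h3 : ∑ c, u c ^ 2 = u ⬝ᵥ u := by simp only [dotProduct, pow_two]
    rw [h3] at h1
    exact h1.trans (mul_le_mul_of_nonneg_right h2 (dotProduct_self_nonneg_real u))
  refine (dotProduct_self_le_card h).trans_eq ?_
  rw [Fintype.card_fin]; ring

end ErrorDynamics

/-! ### Filter identities and growth of the integrated regressor -/

namespace IsClosedLoopSolution

variable {n m : ℕ} {a : ℝ → Matrix (Fin n) (Fin n) ℝ} {k : ℝ → ℝ} {g : Gains} {muIF : ℝ}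
  {b : Fin n → Fin m → ℝ} {x : ℝ → NetState n m}

/-- The difference of the two sides solves the homogeneous filter equation from zero; `wIF_eq` is
the same argument without damping. -/
theorem wF_eq (hx : IsClosedLoopSolution a k g muIF b x) {t : ℝ} (ht : 0 ≤ t) (i : Fin n) :
    (x t).wF i = ((x t).YF i).mulVec (trueParam b) := by
  funext r
  have h := (HasRate.sum Finset.univ fun c _ =>
    (hx.regressorFilter i r c).mul_const (trueParam b c)).sub (hx.controlFilter i r)
  have h0 := h.eq_zero_of_linear (r := g.beta) (by simp [hx.YF_zero, hx.wF_zero])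
    (fun τ _ => ?_) ht
  · exact (sub_eq_zero.1 h0).symm
  · have h1 := congrFun (regressor_mulVec_trueParam g muIF (a τ) (k τ) b (x τ) i) r
    rw [Matrix.mulVec, dotProduct] at h1
    simp only [add_mul, Finset.sum_add_distrib]
    rw [h1, mul_sub, Finset.mul_sum]
    simp only [mul_assoc]
    ring

theorem wIF_eq (hx : IsClosedLoopSolution a k g muIF b x) {t : ℝ} (ht : 0 ≤ t) (i : Fin n) :
    (x t).wIF i = ((x t).YIF i).mulVec (trueParam b) := by
  funext c
  have h := (HasRate.sum Finset.univ fun d _ =>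
    (hx.regressorIntegral i c d).mul_const (trueParam b d)).sub (hx.controlIntegral i c)
  have h0 := h.eq_zero_of_linear (r := 0) (by simp [hx.YIF_zero, hx.wIF_zero])
    (fun τ hτ => ?_) ht
  · exact (sub_eq_zero.1 h0).symm
  · rw [hx.wF_eq hτ, Matrix.mulVec_mulVec, neg_zero, zero_mul]
    exact sub_self _

theorem paramErr_rate (hx : IsClosedLoopSolution a k g muIF b x) (i : Fin n)
    (c : ParamIdx n m) :
    HasRate (fun τ => paramErr b (x τ) i c) fun τ =>
      -((dampingMat g muIF (x τ) i).mulVec (paramErr b (x τ) i) c) -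
        ∑ j, a τ i j * (paramErr b (x τ) i c - paramErr b (x τ) j c) := by
  have h := (HasRate.const (trueParam b c)).sub (hx.adaptation i c)
  refine h.congr fun τ hτ => ?_
  rw [adaptRate_eq g muIF (a τ) b (x τ) i (hx.wF_eq hτ i) (hx.wIF_eq hτ i)]
  ring

theorem YIF_symm (hx : IsClosedLoopSolution a k g muIF b x) {t : ℝ} (ht : 0 ≤ t) (i : Fin n) :
    ((x t).YIF i).IsSymm := by
  ext c d
  have h := (hx.regressorIntegral i d c).sub (hx.regressorIntegral i c d)
  have h0 := h.eq_zero_of_linear (r := 0) (by simp [hx.YIF_zero]) (fun τ _ => ?_) ht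
  · exact sub_eq_zero.1 h0
  · simp only [Matrix.mul_apply, Matrix.transpose_apply, neg_zero, zero_mul]
    rw [sub_eq_zero]
    exact Finset.sum_congr rfl fun r _ => mul_comm _ _

theorem YIF_form_rate (hx : IsClosedLoopSolution a k g muIF b x) (i : Fin n)
    (u : ParamIdx n m → ℝ) :
    HasRate (fun τ => u ⬝ᵥ ((x τ).YIF i).mulVec u) fun τ =>
      u ⬝ᵥ (((x τ).YF i).transpose * (x τ).YF i).mulVec u := by
  exact HasRate.sum Finset.univ fun c _ => (HasRate.sum Finset.univ fun d _ =>
    (hx.regressorIntegral i c d).mul_const (u d)).const_mul (u c)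

theorem YIF_form_mono (hx : IsClosedLoopSolution a k g muIF b x) (i : Fin n)
    (u : ParamIdx n m → ℝ) {s t : ℝ} (hs : 0 ≤ s) (hst : s ≤ t) :
    u ⬝ᵥ ((x s).YIF i).mulVec u ≤ u ⬝ᵥ ((x t).YIF i).mulVec u := by
  have := (hx.YIF_form_rate i u).neg.le_of_rate_nonpos hs hst fun τ _ _ => by
    rw [gram_form, Left.neg_nonpos_iff]; exact dotProduct_self_nonneg_real _
  linarith

theorem YIF_form_nonneg (hx : IsClosedLoopSolution a k g muIF b x) (i : Fin n)
    (u : ParamIdx n m → ℝ) {t : ℝ} (ht : 0 ≤ t) : 0 ≤ u ⬝ᵥ ((x t).YIF i).mulVec u := by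
  have := hx.YIF_form_mono i u le_rfl ht
  rwa [hx.YIF_zero, Matrix.zero_mulVec, dotProduct_zero] at this

theorem YIF_form_sub_le (hx : IsClosedLoopSolution a k g muIF b x) {B : ℝ}
    (hB : ∀ t, 0 ≤ t → ∀ i r c, |(x t).YF i r c| ≤ B) (i : Fin n)
    (u : ParamIdx n m → ℝ) {s t : ℝ} (hs : 0 ≤ s) (hst : s ≤ t) :
    u ⬝ᵥ ((x t).YIF i).mulVec u - u ⬝ᵥ ((x s).YIF i).mulVec u ≤
      m * (Fintype.card (ParamIdx n m) * B ^ 2) * (t - s) * (u ⬝ᵥ u) := by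
  have h := hx.YIF_form_rate i u
  rw [h.sub_eq_integral hs (hs.trans hst)]
  have := intervalIntegral.integral_mono_on hst (h.intervalIntegrable hs (hs.trans hst))
    (by simp) fun τ hτ => gram_form_le (hB τ (hs.trans hτ.1) i) u
  rw [intervalIntegral.integral_const, smul_eq_mul] at this
  linarith

theorem YIF_linear_growth (hx : IsClosedLoopSolution a k g muIF b x) {B : ℝ}
    (hB : ∀ t, 0 ≤ t → ∀ i r c, |(x t).YF i r c| ≤ B) (i : Fin n) (c d : ParamIdx n m) {t : ℝ}
    (ht : 0 ≤ t) : |(x t).YIF i c d| ≤ m * B ^ 2 * t := by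
  have h := hx.regressorIntegral i c d
  have h1 : |∫ τ in (0 : ℝ)..t, (((x τ).YF i).transpose * (x τ).YF i) c d| ≤
      ∫ _ in (0 : ℝ)..t, m * B ^ 2 := by
    rw [← Real.norm_eq_abs]
    refine intervalIntegral.norm_integral_le_of_norm_le ht (Filter.Eventually.of_forall
      fun τ hτ => ?_) (by simp)
    rw [Real.norm_eq_abs, Matrix.mul_apply]
    refine (Finset.abs_sum_le_sum_abs _ _).trans ?_
    have h2 : ∀ r ∈ Finset.univ, |((x τ).YF i).transpose c r * (x τ).YF i r d| ≤ B ^ 2 :=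
      fun r _ => by
        rw [Matrix.transpose_apply, abs_mul, pow_two]
        exact mul_le_mul (hB τ hτ.1.le i r c) (hB τ hτ.1.le i r d) (abs_nonneg _)
          ((abs_nonneg _).trans (hB τ hτ.1.le i r c))
    simpa using Finset.sum_le_sum h2
  have h2 := (h t ht).2
  beta_reduce at h2
  rw [hx.YIF_zero, Matrix.zero_apply, zero_add] at h2
  rw [h2]
  refine h1.trans_eq ?_
  rw [intervalIntegral.integral_const, smul_eq_mul, sub_zero, mul_comm]

theorem dampingMat_form_nonneg (hx : IsClosedLoopSolution a k g muIF b x) (hg : g.Positive)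
    (hmu : 0 < muIF) {t : ℝ} (ht : 0 ≤ t) (i : Fin n) (u : ParamIdx n m → ℝ) :
    0 ≤ u ⬝ᵥ (dampingMat g muIF (x t) i).mulVec u := by
  rw [dampingMat, Matrix.add_mulVec, Matrix.smul_mulVec, Matrix.smul_mulVec, dotProduct_add,
    dotProduct_smul, dotProduct_smul, gram_form, smul_eq_mul, smul_eq_mul]
  exact add_nonneg (mul_nonneg hg.muF_pos.le (dotProduct_self_nonneg_real _))
    (mul_nonneg hmu.le (hx.YIF_form_nonneg i u ht))

/-- Collective initial excitation makes the integrated regressors jointly positive definite. -/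
theorem excitation_le (hx : IsClosedLoopSolution a k g muIF b x) {t₀ Tbar γ : ℝ}
    (hc : IsCIE (fun t => (x t).YF) t₀ Tbar γ) (u : ParamIdx n m → ℝ) :
    γ * (u ⬝ᵥ u) ≤ ∑ i, u ⬝ᵥ ((x (t₀ + Tbar)).YIF i).mulVec u := by
  have h0 := hc.start_nonneg
  have h1 : t₀ ≤ t₀ + Tbar := by linarith [hc.window_pos]
  have hE : (Matrix.of fun c d => ∫ τ in t₀..(t₀ + Tbar),
      (∑ i, ((x τ).YF i).transpose * (x τ).YF i) c d) =
      ∑ i, ((x (t₀ + Tbar)).YIF i - (x t₀).YIF i) := by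
    ext c d
    have h := HasRate.sum Finset.univ fun i _ => hx.regressorIntegral i c d
    have h2 := h.sub_eq_integral h0 (h0.trans h1)
    rw [Matrix.of_apply, Matrix.sum_apply]
    simp only [Matrix.sum_apply, Matrix.sub_apply, Finset.sum_sub_distrib]
    exact h2.symm
  have h := hc.excitation.dotProduct_mulVec_nonneg u
  rw [hE, Matrix.sub_mulVec, dotProduct_sub, Matrix.smul_mulVec, Matrix.one_mulVec,
    dotProduct_smul, Matrix.sum_mulVec, dotProduct_sum, star_trivial, smul_eq_mul] at h
  refine (sub_nonneg.1 h).trans (Finset.sum_le_sum fun i _ => ?_)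
  rw [Matrix.sub_mulVec, dotProduct_sub]
  linarith [hx.YIF_form_nonneg i u h0]

end IsClosedLoopSolution

theorem dampingMat_isSymm {n m : ℕ} {g : Gains} {muIF : ℝ} {x : NetState n m} {i : Fin n}
    (h : (x.YIF i).IsSymm) : (dampingMat g muIF x i).IsSymm := by
  rw [Matrix.IsSymm, dampingMat, Matrix.transpose_add, Matrix.transpose_smul,
    Matrix.transpose_smul, Matrix.transpose_mul, Matrix.transpose_transpose, h.eq]

/-! ### Decay of the parameter errors and of the disagreement -/

namespace IsClosedLoopSolution

variable {n m : ℕ} {a : ℝ → Matrix (Fin n) (Fin n) ℝ} {k : ℝ → ℝ} {g : Gains} {muIF : ℝ}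
  {b : Fin n → Fin m → ℝ} {x : ℝ → NetState n m} {aM δ T : ℝ}

theorem energy_antitone (hx : IsClosedLoopSolution a k g muIF b x)
    (ha : IsUndirectedNetwork a aM) (hg : g.Positive) (hmu : 0 < muIF) {s t : ℝ} (hs : 0 ≤ s)
    (hst : s ≤ t) : ∑ i, paramErr b (x t) i ⬝ᵥ paramErr b (x t) i ≤
      ∑ i, paramErr b (x s) i ⬝ᵥ paramErr b (x s) i :=
  (leaky_energy_rate ha hx.paramErr_rate).le_of_rate_nonpos hs hst fun τ hτ _ => by
    have := dissipation_nonneg (ha.nonneg τ (hs.trans hτ))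
      (hx.dampingMat_form_nonneg hg hmu (hs.trans hτ)) (paramErr b (x τ))
    linarith

theorem paramErr_sq_le_energy (i : Fin n) (c : ParamIdx n m) (t : ℝ) :
    paramErr b (x t) i c ^ 2 ≤ ∑ i, paramErr b (x t) i ⬝ᵥ paramErr b (x t) i :=
  (sq_le_dotProduct_self _ c).trans
    (Finset.single_le_sum (f := fun i => paramErr b (x t) i ⬝ᵥ paramErr b (x t) i)
      (fun _ _ => dotProduct_self_nonneg_real _) (Finset.mem_univ i))

theorem paramErr_bdd (hx : IsClosedLoopSolution a k g muIF b x)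
    (ha : IsUndirectedNetwork a aM) (hg : g.Positive) (hmu : 0 < muIF) (i : Fin n)
    (c : ParamIdx n m) : BddSignal fun t => paramErr b (x t) i c :=
  ⟨_, fun t ht => Real.abs_le_sqrt
    ((paramErr_sq_le_energy i c t).trans (hx.energy_antitone ha hg hmu le_rfl ht))⟩

theorem paramErr_expDecay (hx : IsClosedLoopSolution a k g muIF b x)
    (ha : IsUndirectedNetwork a aM) (hδ : 0 < δ) (hT : 0 < T) (hconn : IsJointlyConnected a δ T)
    (hg : g.Positive) (hmu : 0 < muIF) {t₀ Tbar γ : ℝ}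
    (hc : IsCIE (fun t => (x t).YF) t₀ Tbar γ) (i : Fin n) (c : ParamIdx n m) :
    ExpDecay (fun t => paramErr b (x t) i c) (t₀ + Tbar) := by
  obtain ⟨B, hB⟩ := hc.bounded
  have ht₁ : 0 ≤ t₀ + Tbar := add_nonneg hc.start_nonneg hc.window_pos.le
  obtain ⟨L, hL⟩ : ∃ L : ℝ, L = m * (Fintype.card (ParamIdx n m) * B ^ 2) := ⟨_, rfl⟩
  have hL0 : 0 ≤ L := by rw [hL]; positivity
  have hmuF := hg.muF_pos
  -- The terms of K bound the gram term, the growth of Y_IF over one window, and Y_IF at the end of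
  -- the excitation window, which serves as N; the 1 ensures K > 0.
  obtain ⟨C, hC, hcontr⟩ := exists_leaky_consensus_contraction (κ := ParamIdx n m) ha hδ hT hconn
    (K := g.muF * L + muIF * (L * T) + muIF * (L * (t₀ + Tbar)) + 1) (γ := muIF * γ)
    (by positivity) (mul_pos hmu hc.level_pos)
  have hsmul : ∀ (r : ℝ) (A : Matrix (ParamIdx n m) (ParamIdx n m) ℝ) (u : ParamIdx n m → ℝ),
      u ⬝ᵥ (r • A).mulVec u = r * (u ⬝ᵥ A.mulVec u) := fun r A u => by
    rw [Matrix.smul_mulVec, dotProduct_smul, smul_eq_mul]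
  have hdiff : ∀ (τ t : ℝ) (i : Fin n) (u : ParamIdx n m → ℝ),
      u ⬝ᵥ (dampingMat g muIF (x τ) i - muIF • (x t).YIF i).mulVec u =
        g.muF * (u ⬝ᵥ (((x τ).YF i).transpose * (x τ).YF i).mulVec u) + muIF *
          (u ⬝ᵥ ((x τ).YIF i).mulVec u - u ⬝ᵥ ((x t).YIF i).mulVec u) := fun τ t i u => by
    rw [dampingMat, Matrix.sub_mulVec, Matrix.add_mulVec, dotProduct_sub, dotProduct_add, hsmul,
      hsmul, hsmul]
    ring
  have hV : ExpDecay (fun t => ∑ i, paramErr b (x t) i ⬝ᵥ paramErr b (x t) i) (t₀ + Tbar) := by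
    -- V(t + T) ≤ C (V(t) - V(t + T)) rearranges to this ρ. There is no input, so Q = 0 and the
    -- input rate 1 is arbitrary.
    refine ExpDecay.of_window_contraction (ρ := C / (1 + C)) (Q := 0) hT (by positivity)
      ((div_lt_one (by positivity)).2 (by linarith)) one_pos
      (fun t _ => Finset.sum_nonneg fun i _ => dotProduct_self_nonneg_real _)
      (fun t ht _ => hx.energy_antitone ha hg hmu ht₁ ht) fun t ht => ?_
    have ht0 := ht₁.trans ht
    have h := hcontr (fun τ => paramErr b (x τ)) (fun τ => dampingMat g muIF (x τ))
      (fun i => muIF • (x t).YIF i) (fun i => muIF • (x (t₀ + Tbar)).YIF i) t ht0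
      hx.paramErr_rate
      (fun i => (hx.YIF_symm ht0 i).smul _)
      (fun i u => by rw [hsmul]; exact mul_nonneg hmu.le (hx.YIF_form_nonneg i u ht₁))
      (fun i u => by
        have h1 := hx.YIF_form_sub_le hB i u le_rfl ht₁
        rw [hx.YIF_zero, Matrix.zero_mulVec, dotProduct_zero, sub_zero, sub_zero, ← hL] at h1
        have h2 := mul_le_mul_of_nonneg_left h1 hmu.le
        have h3 := dotProduct_self_nonneg_real u
        have h4 : 0 ≤ (g.muF * L + muIF * (L * T) + 1) * (u ⬝ᵥ u) := by positivity
        rw [hsmul]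
        linarith)
      (fun i u => by
        rw [hsmul, hsmul]
        exact mul_le_mul_of_nonneg_left (hx.YIF_form_mono i u ht₁ ht) hmu.le)
      (fun u => by
        simp only [hsmul]
        rw [← Finset.mul_sum, mul_assoc]
        exact mul_le_mul_of_nonneg_left (hx.excitation_le hc u) hmu.le)
      (fun τ hτ i => (dampingMat_isSymm (hx.YIF_symm (ht0.trans hτ.1) i)).sub
        ((hx.YIF_symm ht0 i).smul _))
      (fun τ hτ i u => by
        rw [hdiff, gram_form]
        exact add_nonneg (mul_nonneg hmuF.le (dotProduct_self_nonneg_real _))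
          (mul_nonneg hmu.le (sub_nonneg.2 (hx.YIF_form_mono i u ht0 hτ.1))))
      (fun τ hτ i u => by
        have h1 := gram_form_le (hB τ (ht0.trans hτ.1) i) u
        have h2 := hx.YIF_form_sub_le hB i u ht0 hτ.1
        have h3 := dotProduct_self_nonneg_real u
        rw [← hL] at h1 h2
        have h4 : L * (τ - t) * (u ⬝ᵥ u) ≤ L * T * (u ⬝ᵥ u) :=
          mul_le_mul_of_nonneg_right (mul_le_mul_of_nonneg_left (by linarith [hτ.2]) hL0) h3
        have h5 := mul_le_mul_of_nonneg_left h1 hmuF.le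
        have h6 := mul_le_mul_of_nonneg_left (h2.trans h4) hmu.le
        have h7 : 0 ≤ (muIF * (L * (t₀ + Tbar)) + 1) * (u ⬝ᵥ u) := by positivity
        rw [hdiff]
        linarith)
    rw [zero_mul, add_zero, div_mul_eq_mul_div, le_div_iff₀ (by positivity)]
    linarith
  refine ExpDecay.of_sq (hV.mono fun t ht => ?_)
  rw [abs_of_nonneg (sq_nonneg _), abs_of_nonneg
    (Finset.sum_nonneg fun i _ => dotProduct_self_nonneg_real _)]
  exact paramErr_sq_le_energy i c t

/-- The adaptation rate decays exponentially, although the gain `Y_IF` may grow linearly. -/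
theorem adaptRate_expDecay (hx : IsClosedLoopSolution a k g muIF b x)
    (ha : IsUndirectedNetwork a aM) {t₁ : ℝ} (ht₁ : 0 ≤ t₁) {B : ℝ}
    (hB : ∀ t, 0 ≤ t → ∀ i r c, |(x t).YF i r c| ≤ B)
    (h : ∀ i c, ExpDecay (fun t => paramErr b (x t) i c) t₁) (i : Fin n) (c : ParamIdx n m) :
    ExpDecay (fun t => adaptRate g muIF (a t) (x t) i c) t₁ := by
  have hgrow : ∀ d t, t₁ ≤ t → |dampingMat g muIF (x t) i c d| ≤
      (|g.muF| * (m * B ^ 2) + |muIF| * (m * B ^ 2) * (1 + t₁)) * (1 + (t - t₁)) := by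
    intro d t ht
    have ht0 := ht₁.trans ht
    have h1 := hx.YIF_linear_growth hB i c d ht0
    have h2 : |(((x t).YF i).transpose * (x t).YF i) c d| ≤ m * B ^ 2 := by
      rw [Matrix.mul_apply]
      refine (Finset.abs_sum_le_sum_abs _ _).trans ?_
      have h2 : ∀ r ∈ Finset.univ, |((x t).YF i).transpose c r * (x t).YF i r d| ≤ B ^ 2 :=
        fun r _ => by
          rw [Matrix.transpose_apply, abs_mul, pow_two]
          exact mul_le_mul (hB t ht0 i r c) (hB t ht0 i r d) (abs_nonneg _)
            ((abs_nonneg _).trans (hB t ht0 i r c))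
      simpa using Finset.sum_le_sum h2
    have hu : 0 ≤ t - t₁ := by linarith
    calc _ = |g.muF * (((x t).YF i).transpose * (x t).YF i) c d + muIF * (x t).YIF i c d| := rfl
      _ ≤ |g.muF| * (m * B ^ 2) + |muIF| * (m * B ^ 2 * t) := by
        refine (abs_add_le _ _).trans ?_
        rw [abs_mul, abs_mul]
        exact add_le_add (mul_le_mul_of_nonneg_left h2 (abs_nonneg _))
          (mul_le_mul_of_nonneg_left h1 (abs_nonneg _))
      _ ≤ |g.muF| * (m * B ^ 2) * (1 + (t - t₁)) +
          |muIF| * (m * B ^ 2 * ((1 + t₁) * (1 + (t - t₁)))) := by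
        have h3 : t ≤ (1 + t₁) * (1 + (t - t₁)) := by nlinarith
        exact add_le_add (le_mul_of_one_le_right (by positivity) (by linarith)) (by gcongr)
      _ = _ := by ring
  have hab : ∀ j t, t₁ ≤ t → |a t i j| ≤ aM := fun j t ht => by
    rw [abs_of_nonneg (ha.nonneg t (ht₁.trans ht) i j)]
    exact ha.bounded t (ht₁.trans ht) i j
  have h1 := (ExpDecay.sum Finset.univ fun d _ => (h i d).linearGrowth_mul (hgrow d)).add
    (ExpDecay.sum Finset.univ fun j _ => ((h i c).sub (h j c)).bdd_mul (hab j))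
  refine h1.congr fun t ht => ?_
  rw [adaptRate_eq g muIF (a t) b (x t) i (hx.wF_eq (ht₁.trans ht) i)
    (hx.wIF_eq (ht₁.trans ht) i)]
  rfl

/-- The last two terms of the control cancel the derivative of lam (q_i + (b_i - bhat_i^i) / 2),
which leaves consensus driven by the parameter error. -/
theorem sVar_rate (hx : IsClosedLoopSolution a k g muIF b x) (i : Fin n) (c : Fin m) :
    HasRate (fun t => sVar g b (x t) i c) fun t =>
      -g.sigma * (∑ j, a t i j * (sVar g b (x t) i c - sVar g b (x t) j c)) +
        (Zmat (a t) (k t) i).mulVec (paramErr b (x t) i) c := by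
  have h := (hx.velocity i c).add (((hx.position i c).add
    (((HasRate.const (b i c)).sub (hx.adaptation i (Sum.inr (i, c)))).const_mul (1 / 2))).const_mul
      g.lam)
  refine h.congr fun t _ => ?_
  simp only [controlLaw, Pi.sub_apply, Pi.smul_apply, smul_eq_mul]
  rw [sum_laplacianMat_smul]
  simp only [ownBiasErrRate]
  ring

theorem Zmat_bdd (ha : IsUndirectedNetwork a aM) {kM : ℝ} (hk : ∀ t, 0 ≤ t → |k t| ≤ kM)
    (i : Fin n) (r : Fin m) (c : ParamIdx n m) : BddSignal fun t => Zmat (a t) (k t) i r c := by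
  have hA : ∀ i j, BddSignal fun t => a t i j := fun i j => ⟨aM, fun t ht => by
    rw [abs_of_nonneg (ha.nonneg t ht i j)]; exact ha.bounded t ht i j⟩
  rcases c with c | ⟨j, d⟩
  · exact BddSignal.const 0
  · simp only [Zmat, Matrix.of_apply, Sum.elim_inr]
    split_ifs
    · refine ((BddSignal.const (-(1 / 2))).mul ⟨kM, hk⟩).mul ?_
      have hD : BddSignal fun t => degreeMat (a t) i j := by
        by_cases hij : i = j
        · subst hij
          simpa only [degreeMat, Matrix.diagonal_apply_eq] using
            BddSignal.sum Finset.univ fun l _ => hA i l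
        · simpa only [degreeMat, Matrix.diagonal_apply_ne _ hij] using BddSignal.const 0
      exact hD.add (hA i j)
    · exact BddSignal.const 0

theorem sVar_sub_expDecay (hx : IsClosedLoopSolution a k g muIF b x)
    (ha : IsUndirectedNetwork a aM) (hδ : 0 < δ) (hT : 0 < T) (hconn : IsJointlyConnected a δ T)
    (hg : g.Positive) {t₁ : ℝ} (ht₁ : 0 ≤ t₁)
    (hd : ∀ i c, ExpDecay
      (fun t => (Zmat (a t) (k t) i).mulVec (paramErr b (x t) i) c) t₁)
    (i j : Fin n) (c : Fin m) :
    ExpDecay (fun t => sVar g b (x t) i c - sVar g b (x t) j c) t₁ := by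
  have hn : (n : ℝ) ≠ 0 := by
    have := i.pos
    exact_mod_cast this.ne'
  obtain ⟨s, hs⟩ : ∃ s : ℝ → Fin n → ℝ, s = fun t i => sVar g b (x t) i c := ⟨_, rfl⟩
  obtain ⟨d, hd'⟩ : ∃ d : ℝ → Fin n → ℝ,
    d = fun t i => (Zmat (a t) (k t) i).mulVec (paramErr b (x t) i) c := ⟨_, rfl⟩
  have hsr : ∀ i, HasRate (fun t => s t i) fun t =>
      -g.sigma * (∑ j, a t i j * (s t i - s t j)) + d t i := fun i => by
    rw [hs, hd']; exact hx.sVar_rate i c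
  have hdd : ∀ i, ExpDecay (fun t => d t i) t₁ := fun i => by rw [hd']; exact hd i c
  -- Removing the mean gives consensus with a mean-free state and a mean-free input.
  have he : ∀ i, HasRate (fun t => s t i - (n : ℝ)⁻¹ * ∑ j, s t j) fun t =>
      -g.sigma * (∑ j, a t i j * ((s t i - (n : ℝ)⁻¹ * ∑ j, s t j) -
        (s t j - (n : ℝ)⁻¹ * ∑ j, s t j))) + (d t i - (n : ℝ)⁻¹ * ∑ j, d t j) := fun i => by
    refine ((hsr i).sub ((HasRate.sum Finset.univ fun j _ => hsr j).const_mul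
      (n : ℝ)⁻¹)).congr fun t ht => ?_
    have h0 := laplacian_sum_eq_zero (ha.symm t ht) (s t)
    rw [Finset.sum_add_distrib, ← Finset.mul_sum, h0]
    simp only [sub_sub_sub_cancel_right]
    ring
  have hdm : ∀ i, ExpDecay (fun t => d t i - (n : ℝ)⁻¹ * ∑ j, d t j) t₁ := fun i =>
    (hdd i).sub ((ExpDecay.sum Finset.univ fun j _ => hdd j).const_mul _)
  have hdb : ∀ i, ExpDecay (fun t => (d t i - (n : ℝ)⁻¹ * ∑ j, d t j) ^ 2) t₁ := fun i => by
    obtain ⟨C, α, hC, hα, -, h⟩ := (hdm i).exists_rate_le one_pos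
    refine ((hdm i).bdd_mul (B := C) fun t ht => (h t ht).trans
      (mul_le_of_le_one_right hC (Real.exp_le_one_iff.2 (by nlinarith)))).congr fun t _ => ?_
    rw [pow_two]
  obtain ⟨Q, α, hQ, hα, -, hη⟩ :=
    (ExpDecay.sum Finset.univ fun i _ => hdb i).exists_rate_le one_pos
  obtain ⟨ρ, C, hρ, hρ1, hC, hcontr⟩ := exists_consensus_contraction ha hδ hT hconn hg.sigma_pos
  have hcont : ContinuousOn (fun t => ∑ i, (s t i - (n : ℝ)⁻¹ * ∑ j, s t j) ^ 2) (Set.Ici 0) :=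
    continuousOn_finsetSum _ fun i _ => (he i).continuousOn.pow 2
  obtain ⟨B, hB⟩ := isCompact_Icc.exists_bound_of_continuousOn (hcont.mono
    (fun r hr => ht₁.trans hr.1 : Set.Icc t₁ (t₁ + T) ⊆ _))
  have hE : ExpDecay (fun t => ∑ i, (s t i - (n : ℝ)⁻¹ * ∑ j, s t j) ^ 2) t₁ := by
    refine ExpDecay.of_window_contraction (Q := C * Q) hT hρ hρ1 hα
      (fun t _ => Finset.sum_nonneg fun i _ => sq_nonneg _)
      (fun t h1 h2 => (le_abs_self _).trans (hB t ⟨h1, h2⟩)) fun t ht => ?_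
    -- The exponential majorant of the squared inputs is decreasing, so its value at the start of
    -- the window serves as η.
    refine (hcontr (fun t i => s t i - (n : ℝ)⁻¹ * ∑ j, s t j)
      (fun t i => d t i - (n : ℝ)⁻¹ * ∑ j, d t j) t (Q * Real.exp (-α * (t - t₁)))
      (ht₁.trans ht) he (fun τ _ => ?_) fun τ hτ i => ?_).trans_eq (by ring)
    · rw [Finset.sum_sub_distrib, Finset.sum_const, Finset.card_univ, Fintype.card_fin,
        nsmul_eq_mul]
      field_simp
      ring
    · have h1 : (d τ i - (n : ℝ)⁻¹ * ∑ j, d τ j) ^ 2 ≤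
          ∑ i, (d τ i - (n : ℝ)⁻¹ * ∑ j, d τ j) ^ 2 :=
        Finset.single_le_sum (f := fun i => (d τ i - (n : ℝ)⁻¹ * ∑ j, d τ j) ^ 2)
          (fun i _ => sq_nonneg _) (Finset.mem_univ i)
      have h2 := (le_abs_self _).trans (hη τ (ht.trans hτ.1))
      refine (h1.trans h2).trans (mul_le_mul_of_nonneg_left (Real.exp_le_exp.2 ?_) hQ)
      nlinarith [hτ.1]
  have hei : ∀ i, ExpDecay (fun t => s t i - (n : ℝ)⁻¹ * ∑ j, s t j) t₁ := fun i => by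
    refine ExpDecay.of_sq (hE.mono fun t _ => ?_)
    rw [abs_of_nonneg (sq_nonneg _), abs_of_nonneg (Finset.sum_nonneg fun i _ => sq_nonneg _)]
    exact Finset.single_le_sum (f := fun i => (s t i - (n : ℝ)⁻¹ * ∑ j, s t j) ^ 2)
      (fun i _ => sq_nonneg _) (Finset.mem_univ i)
  refine ((hei i).sub (hei j)).congr fun t _ => ?_
  rw [hs, sub_sub_sub_cancel_right]

end IsClosedLoopSolution

/-! ### From coordinates to vectors, and the main theorem -/

theorem expConvergesToZero_of_expDecay {p : ℕ} {y : ℝ → Fin p → ℝ} {t₁ : ℝ}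
    (h : ∀ c, ExpDecay (fun t => y t c) t₁) : ExpConvergesToZero y t₁ := by
  have h1 : ExpDecay (fun t => ∑ c, |y t c|) t₁ :=
    ExpDecay.sum Finset.univ fun c _ => (h c).mono fun t _ => (abs_abs _).le
  obtain ⟨C, α, hα, h2⟩ := h1
  refine ⟨C, α, hα, fun t ht => ?_⟩
  refine ((pi_norm_le_iff_of_nonneg (Finset.sum_nonneg fun c _ => abs_nonneg (y t c))).2
    fun c => ?_).trans ((le_abs_self _).trans (h2 t ht))
  exact Finset.single_le_sum (f := fun c => |y t c|) (fun c _ => abs_nonneg _)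
    (Finset.mem_univ c)

theorem uniformlyBounded_of_bddSignal {ι : Type} [Fintype ι] {y : ℝ → ι → ℝ}
    (h : ∀ c, BddSignal fun t => y t c) : UniformlyBounded y := by
  have h1 : BddSignal fun t => ∑ c, |y t c| := BddSignal.sum Finset.univ fun c _ => by
    obtain ⟨B, hB⟩ := h c
    exact ⟨B, fun t ht => (abs_abs _).trans_le (hB t ht)⟩
  obtain ⟨B, hB⟩ := h1
  refine ⟨B, fun t ht => ?_⟩
  refine ((pi_norm_le_iff_of_nonneg (Finset.sum_nonneg fun c _ => abs_nonneg (y t c))).2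
    fun c => ?_).trans ((le_abs_self _).trans (hB t ht))
  exact Finset.single_le_sum (f := fun c => |y t c|) (fun c _ => abs_nonneg _)
    (Finset.mem_univ c)

theorem theorem1 (n m : ℕ) (a : ℝ → Matrix (Fin n) (Fin n) ℝ) (aM δ T : ℝ)
    (ha : IsUndirectedNetwork a aM) (hδ : 0 < δ) (hT : 0 < T) (hconn : IsJointlyConnected a δ T)
    (k : ℝ → ℝ) (kM : ℝ) (hk_meas : AEMeasurable k (MeasureTheory.volume.restrict (Set.Ici 0)))
    (hk_pos : ∀ t, 0 ≤ t → 0 < k t) (hk_le : ∀ t, 0 ≤ t → k t ≤ kM)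
    (g : Gains) (hg : g.Positive) :
    ∃ muStar : ℝ, 0 < muStar ∧ ∀ muIF : ℝ, muStar < muIF →
      ∀ (b : Fin n → Fin m → ℝ) (x : ℝ → NetState n m), IsClosedLoopSolution a k g muIF b x →
        ∀ t₀ Tbar γ : ℝ, IsCIE (fun t => (x t).YF) t₀ Tbar γ →
          (∀ i j, ExpConvergesToZero (fun t => (x t).q i - (x t).q j) (t₀ + Tbar)) ∧
          (∀ i, ExpConvergesToZero (fun t => (x t).v i) (t₀ + Tbar)) ∧
          (∀ i l, ExpConvergesToZero (fun t => b i - biasEst (x t) i l) (t₀ + Tbar)) ∧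
          (∀ i, UniformlyBounded (fun t => (x t).q i)) ∧
          (∀ i, UniformlyBounded (fun t => (x t).v i)) ∧
          (∀ i, UniformlyBounded (fun t => sVar g b (x t) i)) ∧
          (∀ i, UniformlyBounded (fun t => paramErr b (x t) i)) ∧
          (∀ i, UniformlyBounded (fun t => auxControl g muIF (a t) (k t) b (x t) i)) := by
  -- The threshold 1 is arbitrary: the contraction argument works for every positive `muIF`.
  refine ⟨1, one_pos, fun muIF hmu1 b x hx t₀ Tbar γ hc => ?_⟩
  have hmu : 0 < muIF := one_pos.trans hmu1
  have ht₁ : 0 ≤ t₀ + Tbar := add_nonneg hc.start_nonneg hc.window_pos.le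
  obtain ⟨t₁, hdef⟩ : ∃ t₁, t₁ = t₀ + Tbar := ⟨_, rfl⟩
  obtain ⟨B, hB⟩ := hc.bounded
  have hp := fun i c => hx.paramErr_expDecay ha hδ hT hconn hg hmu hc i c
  rw [← hdef] at ht₁ ⊢
  simp only [← hdef] at hp
  have hpb := hx.paramErr_bdd ha hg hmu
  have hkb : BddSignal k := ⟨kM, fun t ht => (abs_of_pos (hk_pos t ht)).trans_le (hk_le t ht)⟩
  have hAb : ∀ i j, BddSignal fun t => a t i j := fun i j => ⟨aM, fun t ht => by
    rw [abs_of_nonneg (ha.nonneg t ht i j)]; exact ha.bounded t ht i j⟩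
  have hZb := IsClosedLoopSolution.Zmat_bdd (m := m) ha
    fun t ht => (abs_of_pos (hk_pos t ht)).trans_le (hk_le t ht)
  have hZ : ∀ i c, ExpDecay
      (fun t => (Zmat (a t) (k t) i).mulVec (paramErr b (x t) i) c) t₁ := fun i c => by
    refine ExpDecay.sum Finset.univ fun d _ => ?_
    obtain ⟨B', hB'⟩ := hZb i c d
    exact (hp i d).bdd_mul fun t ht => hB' t (ht₁.trans ht)
  have hss := hx.sVar_sub_expDecay ha hδ hT hconn hg ht₁ hZ
  have hLs : ∀ i c, ExpDecay (fun t => -g.sigma *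
      (∑ j, a t i j * (sVar g b (x t) i c - sVar g b (x t) j c)) +
        (Zmat (a t) (k t) i).mulVec (paramErr b (x t) i) c) t₁ := fun i c => by
    refine ((ExpDecay.sum Finset.univ fun j _ => ?_).const_mul _).add (hZ i c)
    obtain ⟨B', hB'⟩ := hAb i j
    exact (hss i j c).bdd_mul fun t ht => hB' t (ht₁.trans ht)
  have hsb : ∀ i c, BddSignal fun t => sVar g b (x t) i c := fun i c =>
    BddSignal.of_rate_expDecay ht₁ (hx.sVar_rate i c) (hLs i c)
  have had := hx.adaptRate_expDecay ha ht₁ hB hp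
  have hv : ∀ i c, ExpDecay (fun t => (x t).v i c) t₁ := fun i c => by
    refine ExpDecay.of_linear hg.lam_pos ht₁ (hx.velocity i c) (fun t _ => ?_)
      ((hLs i c).add ((had i (Sum.inr (i, c))).const_mul (g.lam / 2)))
    simp only [controlLaw, Pi.sub_apply, Pi.smul_apply, smul_eq_mul]
    rw [sum_laplacianMat_smul]
    simp only [ownBiasErrRate]
    ring
  have hbias : ∀ i l c, ExpDecay (fun t => (b i - biasEst (x t) i l) c) t₁ := fun i l c =>
    hp l (Sum.inr (i, c))
  have hvb : ∀ i c, BddSignal fun t => (x t).v i c := fun i c =>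
    BddSignal.of_expDecay (hx.velocity i c).continuousOn (hv i c)
  -- The weights are merely measurable, so decay from t₁ on and compactness of [0, t₁] do not
  -- suffice to bound the adaptation rate; it is bounded term by term. The product of Y_IF with the
  -- error is continuous and decaying, hence bounded.
  have hadb : ∀ i c, BddSignal fun t => adaptRate g muIF (a t) (x t) i c := fun i c => by
    have hYb : ∀ r d, BddSignal fun t => (x t).YF i r d := fun r d =>
      ⟨B, fun t ht => hB t ht i r d⟩
    have h1 : ∀ d, BddSignal fun t => dampingMat g muIF (x t) i c d * paramErr b (x t) i d := by
      intro d
      have h2 : BddSignal fun t => (x t).YIF i c d * paramErr b (x t) i d := by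
        refine BddSignal.of_expDecay ((hx.regressorIntegral i c d).continuousOn.mul
          (hx.paramErr_rate i d).continuousOn) (t₁ := t₁) ?_
        refine (hp i d).linearGrowth_mul (B := m * B ^ 2 * (1 + t₁)) fun t ht =>
          (hx.YIF_linear_growth hB i c d (ht₁.trans ht)).trans ?_
        rw [mul_assoc (m * B ^ 2 : ℝ)]
        exact mul_le_mul_of_nonneg_left (by nlinarith) (by positivity)
      have h3 : BddSignal fun t => (((x t).YF i).transpose * (x t).YF i) c d :=
        BddSignal.sum Finset.univ fun r _ => (hYb r c).mul (hYb r d)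
      refine (((h3.mul (hpb i d)).const_mul g.muF).add (h2.const_mul muIF)).congr fun t _ => ?_
      simp only [dampingMat, Matrix.add_apply, Matrix.smul_apply, smul_eq_mul]
      ring
    refine ((BddSignal.sum Finset.univ fun d _ => h1 d).add (BddSignal.sum Finset.univ fun j _ =>
      (hAb i j).mul ((hpb i c).sub (hpb j c)))).congr fun t ht => ?_
    rw [adaptRate_eq g muIF (a t) b (x t) i (hx.wF_eq ht i) (hx.wIF_eq ht i)]
    rfl
  refine ⟨fun i j => expConvergesToZero_of_expDecay fun c => ?_,
    fun i => expConvergesToZero_of_expDecay (hv i),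
    fun i l => expConvergesToZero_of_expDecay (hbias i l),
    fun i => uniformlyBounded_of_bddSignal fun c =>
      BddSignal.of_rate_expDecay ht₁ (hx.position i c) (hv i c),
    fun i => uniformlyBounded_of_bddSignal (hvb i),
    fun i => uniformlyBounded_of_bddSignal (hsb i),
    fun i => uniformlyBounded_of_bddSignal (hpb i),
    fun i => uniformlyBounded_of_bddSignal fun c => ?_⟩
  -- The definition of s_i, read as a first-order equation for q_i - q_j with damping λ.
  · refine ExpDecay.of_linear hg.lam_pos ht₁ ((hx.position i c).sub (hx.position j c))
      (fun t _ => ?_) ((hss i j c).sub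
        (((hbias i i c).sub (hbias j j c)).const_mul (g.lam / 2)))
    simp only [sVar, Pi.add_apply, Pi.sub_apply, Pi.smul_apply, smul_eq_mul]
    ring
  · have hθb : ∀ d, BddSignal fun t => (x t).θhat i d := fun d =>
      ((BddSignal.const (trueParam b d)).sub (hpb i d)).congr fun t _ => by
        simp only [paramErr, Pi.sub_apply, sub_sub_cancel]
    refine ((((hkb.mul (hvb i c)).sub (((hvb i c).add
      ((hadb i (Sum.inr (i, c))).neg.const_mul (1 / 2))).const_mul g.lam)).sub
      ((BddSignal.sum Finset.univ fun j _ => (hAb i j).mul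
        ((hsb i c).sub (hsb j c))).const_mul g.sigma)).sub
      (BddSignal.sum Finset.univ fun d _ => (hZb i c d).mul (hθb d))).congr fun t _ => ?_
    simp only [auxControl, Pi.sub_apply, Pi.add_apply, Pi.smul_apply, smul_eq_mul]
    rw [sum_laplacianMat_smul]
    simp only [ownBiasErrRate, Matrix.mulVec, dotProduct]
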